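/- Let $\mathbb{K}$ be a field of characteristic zero and $(X,\mathcal{O}_X)$ a topological space with a sheaf of commutative $\mathbb{K}$-algebras. A Lie algebroid over $(X,\mathcal{O}_X)$ is an $\mathcal{O}_X$-module $\mathcal{L}$ with the structure of a sheaf of $\mathbb{K}$-Lie algebras and an anchor $\mathfrak{a}:\mathcal{L}\to \mathcal{D}er_{\mathbb{K}}(\mathcal{O}_X)$, which is $\mathcal{O}_X$-linear, a homomorphism of Lie algebras, and satisfies $[D,fD']=f[D,D']+\mathfrak{a}(D)(f)D'$. An $\mathcal{L}$-connection on an $\mathcal{O}_X$-module $\mathcal{E}$ is an $\mathcal{O}_X$-linear map $D\mapsto\nabla_D$ from $\mathcal{L}$ to $\mathcal{E}nd_{\mathbb{K}}(\mathcal{E})$ with $\nabla_D(fs)=f\nabla_D s+\mathfrak{a}(D)(f)s$; it is flat if $\nabla_{[D,D']}=[\nabla_D,\nabla_{D'}]$. Given a morphism of Lie algebroids $\phi:\mathcal{L}'\to\mathcal{L}$, an $\mathcal{L}'$-connection on $\mathcal{E}$ is called an $(\mathcal{L}',\mathcal{L})$-connection if it is the composite of $\phi$ with a connection on $\mathcal{E}$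 of the Lie subalgebroid $\mathrm{Im}(\phi)\subseteq\mathcal{L}$. If $\mathcal{L}$ is locally free of rank $n$ and $\nabla$ is a flat $\mathcal{L}$-connection on $\wedge^n\mathcal{L}$, the corresponding generating operator is the $\mathbb{K}$-linear operator $\Delta$ of degree $-1$ on $\wedge^\bullet\mathcal{L}$ with $\Delta^2=0$ such that $[a,b]:=(-1)^{i}(\Delta(a\wedge b)-\Delta a\wedge b-(-1)^i a\wedge\Delta b)$, for $a\in\wedge^i\mathcal{L}$, is the Gerstenhaber bracket on $\wedge^\bullet\mathcal{L}$ extending the bracket and the anchor of $\mathcal{L}$, and such that $\nabla_D\Lambda=-D\wedge\Delta\Lambda$ for $D\in\mathcal{L}$, $\Lambda\in\wedge^n\mathcal{L}$. With $\partial=(-1)^{n-k}\Delta$ on $\wedge^k\mathcal{L}$, the hyperhomology $\mathbb{H}_k(\mathcal{L},\nabla)$, $k\in\mathbb{Z}$, is the hypercohomology of $X$ in degree $-k$ with coefficients in the complex of sheaves of $\mathbb{K}$-vector spaces $(\wedge^\bullet\mathcal{L},\partial)$, where $\wedge^k\mathcal{L}$ is placed in cohomological degree $-k$. Theorem. Let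 $\mathcal{L}'$ and $\mathcal{L}$ be Lie algebroids over $(X,\mathcal{O}_X)$, both locally free $\mathcal{O}_X$-modules of the same rank $n\in\mathbb{N}$, let $\phi:\mathcal{L}'\to\mathcal{L}$ be an injective morphism of Lie algebroids, and let $\nabla$ be a flat $\mathcal{L}$-connection on $\wedge^n\mathcal{L}$. Then there is a unique $\mathcal{L}'$-connection $\nabla'$ on $\wedge^n\mathcal{L}'$ such that $$\wedge^n\phi(\nabla'_{D}s)=\nabla_{\phi(D)}(\wedge^n\phi(s))$$ for all sections $D$ of $\mathcal{L}'$ and $s$ of $\wedge^n\mathcal{L}'$, and $\nabla'$ is a flat $(\mathcal{L}',\mathcal{L})$-connection. The generating operators of $\nabla$ and of $\nabla'$ exist and are unique, the maps $\wedge^k\phi$ form a morphism of complexes of sheaves $(\wedge^\bullet\mathcal{L}',\partial')\to(\wedge^\bullet\mathcal{L},\partial)$, and this morphism induces a homomorphism of graded $\mathbb{K}$-vector spaces $$\mathbb{H}_\bullet(\phi):\mathbb{H}_\bullet(\mathcal{L}',\nabla')\to\mathbb{H}_\bullet(\mathcal{L},\nabla).$$ -/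

import Mathlib

open CategoryTheory TopologicalSpace Opposite

universe u

noncomputable section

namespace LieAlgd

/-- Sheaves on the topological space `X` with values in a category. -/
abbrev Sh (X : TopCat.{u}) (C : Type*) [Category* C] : Type _ :=
  Sheaf (Opens.grothendieckTopology X) C

section Algebra

/-! ### Functoriality of exterior algebras along a change of rings -/

variable {K : Type u} [Field K] {R S T : Type u} [CommRing R] [Algebra K R] [CommRing S]
  [Algebra K S] [CommRing T] [Algebra K T]
  {M N P : Type u} [AddCommGroup M] [Module K M] [Module R M] [IsScalarTower K R M]
  [AddCommGroup N] [Module K N] [Module S N] [IsScalarTower K S N]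
  [AddCommGroup P] [Module K P] [Module T P] [IsScalarTower K T P]

/-- The homomorphism of exterior algebras induced by a `σ`-semilinear map. -/
def extMap (σ : R →ₐ[K] S) (l : M →ₗ[K] N) (hl : ∀ (r : R) (m : M), l (r • m) = σ r • l m) :
    ExteriorAlgebra R M →ₐ[K] ExteriorAlgebra S N :=
  letI : Algebra R (ExteriorAlgebra S N) :=
    ((algebraMap S (ExteriorAlgebra S N)).comp σ.toRingHom).toAlgebra'
      (fun r a => Algebra.commutes (σ r) a)
  let f : M →ₗ[R] ExteriorAlgebra S N :=
    { toFun := fun m => ExteriorAlgebra.ι S (l m)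
      map_add' := fun a b => by simp
      map_smul' := fun r m => by
        rw [hl, map_smul, Algebra.smul_def, Algebra.smul_def]
        rfl }
  let F : ExteriorAlgebra R M →ₐ[R] ExteriorAlgebra S N :=
    ExteriorAlgebra.lift R ⟨f, fun m => ExteriorAlgebra.ι_sq_zero (l m)⟩
  { F.toRingHom with
    commutes' := fun c => by
      change F (algebraMap K _ c) = _
      rw [IsScalarTower.algebraMap_apply K R (ExteriorAlgebra R M), AlgHom.commutes]
      change algebraMap S (ExteriorAlgebra S N) (σ (algebraMap K R c)) = _
      rw [AlgHom.commutes, ← IsScalarTower.algebraMap_apply] }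

theorem extMap_ι (σ : R →ₐ[K] S) (l : M →ₗ[K] N) (hl) (m : M) :
    extMap σ l hl (ExteriorAlgebra.ι R m) = ExteriorAlgebra.ι S (l m) := by
  let _ : Algebra R (ExteriorAlgebra S N) :=
    ((algebraMap S (ExteriorAlgebra S N)).comp σ.toRingHom).toAlgebra'
      (fun r a => Algebra.commutes (σ r) a)
  exact ExteriorAlgebra.lift_ι_apply R _ _ m

theorem extMap_algebraMap (σ : R →ₐ[K] S) (l : M →ₗ[K] N) (hl) (r : R) :
    extMap σ l hl (algebraMap R _ r) = algebraMap S _ (σ r) := by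
  let _ : Algebra R (ExteriorAlgebra S N) :=
    ((algebraMap S (ExteriorAlgebra S N)).comp σ.toRingHom).toAlgebra'
      (fun r a => Algebra.commutes (σ r) a)
  exact AlgHom.commutes (ExteriorAlgebra.lift R _) r

theorem ext_algHom {A : Type u} [Ring A] [Algebra K A] (F G : ExteriorAlgebra R M →ₐ[K] A)
    (h₀ : ∀ r, F (algebraMap R _ r) = G (algebraMap R _ r))
    (h₁ : ∀ m, F (ExteriorAlgebra.ι R m) = G (ExteriorAlgebra.ι R m)) : F = G := by
  ext a
  induction a using ExteriorAlgebra.induction with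
  | algebraMap r => exact h₀ r
  | ι m => exact h₁ m
  | mul a b ha hb => rw [map_mul, map_mul, ha, hb]
  | add a b ha hb => rw [map_add, map_add, ha, hb]

theorem extMap_mem (σ : R →ₐ[K] S) (l : M →ₗ[K] N) (hl) (k : ℕ) {a : ExteriorAlgebra R M}
    (ha : a ∈ ⋀[R]^k M) : extMap σ l hl a ∈ ⋀[S]^k N := by
  change a ∈ (LinearMap.range (ExteriorAlgebra.ι R) ^ k : Submodule R (ExteriorAlgebra R M)) at ha
  change _ ∈ (LinearMap.range (ExteriorAlgebra.ι S) ^ k : Submodule S (ExteriorAlgebra S N))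
  induction ha using Submodule.pow_induction_on_left' with
  | algebraMap r =>
    rw [extMap_algebraMap, pow_zero]
    exact Submodule.algebraMap_mem _
  | add x y i hx hy h₁ h₂ =>
    rw [map_add]
    exact add_mem h₁ h₂
  | mem_mul m hm i x hx h =>
    obtain ⟨m, rfl⟩ := hm
    rw [map_mul, extMap_ι, pow_succ']
    exact Submodule.mul_mem_mul ⟨_, rfl⟩ h

theorem extMap_comm {R' M' : Type u} [CommRing R'] [Algebra K R'] [AddCommGroup M'] [Module K M']
    [Module R' M'] [IsScalarTower K R' M']
    (σ₁ : R →ₐ[K] S) (l₁ : M →ₗ[K] N) (h₁) (σ₂ : S →ₐ[K] T) (l₂ : N →ₗ[K] P) (h₂)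
    (σ₃ : R →ₐ[K] R') (l₃ : M →ₗ[K] M') (h₃) (σ₄ : R' →ₐ[K] T) (l₄ : M' →ₗ[K] P) (h₄)
    (hσ : ∀ r, σ₂ (σ₁ r) = σ₄ (σ₃ r)) (hl : ∀ m, l₂ (l₁ m) = l₄ (l₃ m)) :
    (extMap σ₂ l₂ h₂).comp (extMap σ₁ l₁ h₁) = (extMap σ₄ l₄ h₄).comp (extMap σ₃ l₃ h₃) := by
  refine ext_algHom _ _ (fun r => ?_) fun m => ?_
  · rw [AlgHom.comp_apply, AlgHom.comp_apply, extMap_algebraMap, extMap_algebraMap,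
      extMap_algebraMap, extMap_algebraMap, hσ]
  · rw [AlgHom.comp_apply, AlgHom.comp_apply, extMap_ι, extMap_ι, extMap_ι, extMap_ι, hl]

end Algebra

variable {K : Type u} [Field K] {X : TopCat.{u}}

/-- The sections over `U` of a sheaf of commutative `K`-algebras. -/
abbrev secO (O : Sh X (CommAlgCat.{u} K)) (U : Opens X) : Type u := O.obj.obj (op U)

/-- The restriction map of the structure sheaf. -/
def resO (O : Sh X (CommAlgCat.{u} K)) {U V : Opens X} (h : V ≤ U) : secO O U →ₐ[K] secO O V :=
  (O.obj.map (homOfLE h).op).hom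

/-- A presheaf of `O`-modules: the sections over `U` form an `O(U)`-module, and the restriction maps
are compatible with the module structures. -/
structure ModulePresheaf (O : Sh X (CommAlgCat.{u} K)) where
  sec : Opens X → Type u
  addCommGroup : ∀ U, AddCommGroup (sec U)
  moduleK : ∀ U, Module K (sec U)
  moduleO : ∀ U, Module (secO O U) (sec U)
  isScalarTower : ∀ U, IsScalarTower K (secO O U) (sec U)
  res : ∀ {U V : Opens X}, V ≤ U → (sec U →ₗ[K] sec V)
  res_self : ∀ {U : Opens X} (s : sec U), res le_rfl s = s
  res_res : ∀ {U V W : Opens X} (h : V ≤ U) (h' : W ≤ V) (s : sec U),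
    res h' (res h s) = res (h'.trans h) s
  res_smul : ∀ {U V : Opens X} (h : V ≤ U) (f : secO O U) (s : sec U),
    res h (f • s) = resO O h f • res h s

attribute [instance] ModulePresheaf.addCommGroup ModulePresheaf.moduleK ModulePresheaf.moduleO
  ModulePresheaf.isScalarTower

/-- The underlying presheaf of `K`-vector spaces. -/
@[reducible]
def ModulePresheaf.toFunctor {O : Sh X (CommAlgCat.{u} K)} (E : ModulePresheaf O) :
    (Opens X)ᵒᵖ ⥤ ModuleCat.{u} K where
  obj U := ModuleCat.of K (E.sec U.unop)
  map i := ModuleCat.ofHom (E.res i.unop.le)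
  map_id U := by
    ext s
    exact E.res_self s
  map_comp i j := by
    ext s
    exact (E.res_res i.unop.le j.unop.le s).symm

/-- A sheaf of `O`-modules. -/
structure ModuleSheaf (O : Sh X (CommAlgCat.{u} K)) extends ModulePresheaf O where
  isSheaf : Presheaf.IsSheaf (Opens.grothendieckTopology X) toModulePresheaf.toFunctor

namespace ModuleSheaf

variable {O : Sh X (CommAlgCat.{u} K)}

/-- The underlying sheaf of `K`-vector spaces. -/
@[reducible]
def toSheaf (E : ModuleSheaf O) : Sh X (ModuleCat.{u} K) :=
  ⟨E.toFunctor, E.isSheaf⟩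

/-- `E` is locally free of rank `n`: every point has an open neighbourhood `U` with `n` sections
whose restrictions to each open `V ⊆ U` form a basis of `E(V)` over `O(V)`, that is, which define
an isomorphism of `O|_U`-modules from `(O|_U)^n` to `E|_U`. -/
def IsLocallyFree (E : ModuleSheaf O) (n : ℕ) : Prop :=
  ∀ x : X, ∃ U : Opens X, x ∈ U ∧ ∃ e : Fin n → E.sec U, ∀ (V : Opens X) (h : V ≤ U),
    LinearIndependent (secO O V) (fun i => E.res h (e i)) ∧
      Submodule.span (secO O V) (Set.range fun i => E.res h (e i)) = ⊤

/-- The data of an `O`-submodule sheaf: submodules of the modules of sections, stable under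
restriction, membership being local. -/
structure Sub (E : ModuleSheaf O) where
  carrier : ∀ U : Opens X, Submodule (secO O U) (E.sec U)
  res_mem : ∀ {U V : Opens X} (h : V ≤ U) {s : E.sec U}, s ∈ carrier U → E.res h s ∈ carrier V
  local_mem : ∀ {U : Opens X} (s : E.sec U),
    (∀ x ∈ U, ∃ (V : Opens X) (h : V ≤ U), x ∈ V ∧ E.res h s ∈ carrier V) → s ∈ carrier U

/-- The presheaf underlying a submodule sheaf. -/
@[reducible]
def Sub.toModulePresheaf {E : ModuleSheaf O} (S : E.Sub) : ModulePresheaf O where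
  sec U := S.carrier U
  addCommGroup _ := inferInstance
  moduleK _ := inferInstance
  moduleO _ := inferInstance
  isScalarTower _ := inferInstance
  res h :=
    { toFun := fun s => ⟨E.res h s.1, S.res_mem h s.2⟩
      map_add' := fun _ _ => Subtype.ext (map_add _ _ _)
      map_smul' := fun c a => Subtype.ext ((E.res h).map_smul c a.1) }
  res_self s := Subtype.ext (E.res_self s.1)
  res_res h h' s := Subtype.ext (E.res_res h h' s.1)
  res_smul h f s := Subtype.ext (E.res_smul h f s.1)

theorem Sub.isSheaf {E : ModuleSheaf O} (S : E.Sub) :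
    Presheaf.IsSheaf (Opens.grothendieckTopology X) S.toModulePresheaf.toFunctor := by
  refine (TopCat.Presheaf.isSheaf_iff_isSheafUniqueGluing S.toModulePresheaf.toFunctor).2 ?_
  intro ι U sf hsf
  have hE := (TopCat.Presheaf.isSheaf_iff_isSheafUniqueGluing E.toFunctor).1 E.isSheaf
  have val : ∀ V : Opens X, S.toModulePresheaf.toFunctor.obj (op V) → E.sec V :=
    fun V s => Subtype.val (p := fun t => t ∈ S.carrier V) s
  obtain ⟨s, hs, hu⟩ := hE U (fun i => Subtype.val (p := fun t => t ∈ S.carrier (U i)) (sf i))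
    (fun i j => congrArg (Subtype.val (p := fun t => t ∈ S.carrier (U i ⊓ U j))) (hsf i j))
  refine ⟨(⟨s, S.local_mem s fun x hx => ?_⟩ : S.carrier (iSup U)),
    fun i => Subtype.ext (hs i), fun t ht => ?_⟩
  · obtain ⟨i, hi⟩ := Opens.mem_iSup.1 hx
    refine ⟨U i, le_iSup U i, hi, ?_⟩
    have := hs i
    change E.res (le_iSup U i) s = Subtype.val (p := fun t => t ∈ S.carrier (U i)) (sf i) at this
    rw [this]
    exact Subtype.property (p := fun t => t ∈ S.carrier (U i)) (sf i)
  · exact Subtype.ext (hu (Subtype.val (p := fun t => t ∈ S.carrier (iSup U)) t)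
      fun i => congrArg (Subtype.val (p := fun t => t ∈ S.carrier (U i))) (ht i))

/-- A submodule sheaf as a sheaf of `O`-modules. -/
def Sub.toModuleSheaf {E : ModuleSheaf O} (S : E.Sub) : ModuleSheaf O where
  toModulePresheaf := S.toModulePresheaf
  isSheaf := S.isSheaf

/-- Sections of a submodule sheaf, as sections of the ambient sheaf. -/
def Sub.val {E : ModuleSheaf O} (S : E.Sub) (U : Opens X) :
    S.toModuleSheaf.sec U →ₗ[secO O U] E.sec U where
  toFun s := Subtype.val (p := fun t => t ∈ S.carrier U) s
  map_add' _ _ := rfl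
  map_smul' _ _ := rfl

theorem Sub.val_mem {E : ModuleSheaf O} (S : E.Sub) {U : Opens X} (s : S.toModuleSheaf.sec U) :
    S.val U s ∈ S.carrier U :=
  Subtype.property (p := fun t => t ∈ S.carrier U) s

theorem Sub.val_injective {E : ModuleSheaf O} (S : E.Sub) (U : Opens X) :
    Function.Injective (S.val U) :=
  fun _ _ h => Subtype.ext h

theorem Sub.val_res {E : ModuleSheaf O} (S : E.Sub) {U V : Opens X} (h : V ≤ U)
    (s : S.toModuleSheaf.sec U) : S.val V (S.toModuleSheaf.res h s) = E.res h (S.val U s) :=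
  rfl

/-- A section of the ambient sheaf lying in a submodule sheaf. -/
def Sub.ofMem {E : ModuleSheaf O} (S : E.Sub) {U : Opens X} (s : E.sec U) (hs : s ∈ S.carrier U) :
    S.toModuleSheaf.sec U :=
  (⟨s, hs⟩ : S.carrier U)

theorem Sub.val_ofMem {E : ModuleSheaf O} (S : E.Sub) {U : Opens X} (s : E.sec U)
    (hs : s ∈ S.carrier U) : S.val U (S.ofMem s hs) = s :=
  rfl

/-- A morphism of sheaves of `O`-modules. -/
structure Hom (E F : ModuleSheaf O) where
  app : ∀ U : Opens X, E.sec U →ₗ[secO O U] F.sec U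
  app_res : ∀ {U V : Opens X} (h : V ≤ U) (s : E.sec U), app V (E.res h s) = F.res h (app U s)

/-! ### The exterior algebra of a sheaf of modules -/

/-- The presheaf of exterior algebras `U ↦ ⋀_{O(U)} E(U)`. -/
def extPresheaf (E : ModuleSheaf O) : (Opens X)ᵒᵖ ⥤ AlgCat.{u} K where
  obj U := AlgCat.of K (ExteriorAlgebra (secO O U.unop) (E.sec U.unop))
  map i := AlgCat.ofHom (extMap (resO O i.unop.le) (E.res i.unop.le) (E.res_smul i.unop.le))
  map_id U := by
    refine AlgCat.hom_ext _ (ext_algHom _ _ (fun r => ?_) fun m => ?_)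
    · refine (extMap_algebraMap _ _ (E.res_smul _) r).trans ?_
      change algebraMap _ _ ((O.obj.map (𝟙 U)).hom r) = _
      rw [CategoryTheory.Functor.map_id]
      rfl
    · refine (extMap_ι _ _ (E.res_smul _) m).trans ?_
      change ExteriorAlgebra.ι _ (E.res le_rfl m) = _
      rw [E.res_self]
      rfl
  map_comp {U V W} i j := by
    refine AlgCat.hom_ext _ (ext_algHom _ _ (fun r => ?_) fun m => ?_)
    · refine (extMap_algebraMap _ _ (E.res_smul _) r).trans ?_
      refine Eq.trans ?_ (congrArg (extMap (resO O j.unop.le) (E.res j.unop.le)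
        (E.res_smul j.unop.le)) (extMap_algebraMap (resO O i.unop.le) (E.res i.unop.le)
        (E.res_smul i.unop.le) r).symm)
      rw [extMap_algebraMap]
      change algebraMap _ _ ((O.obj.map (i ≫ j)).hom r) = _
      rw [Functor.map_comp]
      rfl
    · refine (extMap_ι _ _ (E.res_smul _) m).trans ?_
      refine Eq.trans ?_ (congrArg (extMap (resO O j.unop.le) (E.res j.unop.le)
        (E.res_smul j.unop.le)) (extMap_ι (resO O i.unop.le) (E.res i.unop.le)
        (E.res_smul i.unop.le) m).symm)
      rw [extMap_ι, E.res_res]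

/-- The sheaf of algebras `⋀ E`: the sheaf associated with the presheaf of exterior algebras. -/
def extSheaf (E : ModuleSheaf O) : Sh X (AlgCat.{u} K) :=
  (presheafToSheaf (Opens.grothendieckTopology X) (AlgCat.{u} K)).obj E.extPresheaf

/-- The `K`-algebra of sections of `⋀ E` over `U`; its product is the wedge product. -/
abbrev Ext (E : ModuleSheaf O) (U : Opens X) : Type u := E.extSheaf.obj.obj (op U)

/-- The restriction maps of `⋀ E`. -/
def extRes (E : ModuleSheaf O) {U V : Opens X} (h : V ≤ U) : E.Ext U →ₐ[K] E.Ext V :=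
  (E.extSheaf.obj.map (homOfLE h).op).hom

/-- The canonical map from the presheaf of exterior algebras to the associated sheaf. -/
def toExt (E : ModuleSheaf O) (U : Opens X) :
    ExteriorAlgebra (secO O U) (E.sec U) →ₐ[K] E.Ext U :=
  ((toSheafify (Opens.grothendieckTopology X) E.extPresheaf).app (op U)).hom

theorem extRes_toExt (E : ModuleSheaf O) {U V : Opens X} (h : V ≤ U)
    (a : ExteriorAlgebra (secO O U) (E.sec U)) :
    E.extRes h (E.toExt U a) = E.toExt V (extMap (resO O h) (E.res h) (E.res_smul h) a) :=
  (ConcreteCategory.congr_hom ((toSheafify (Opens.grothendieckTopology X) E.extPresheaf).naturality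
    (homOfLE h).op) a).symm

/-- A section of `O`, as a section of `⋀ E` of degree zero. -/
def ofO (E : ModuleSheaf O) (U : Opens X) : secO O U →ₐ[K] E.Ext U :=
  (E.toExt U).comp (IsScalarTower.toAlgHom K (secO O U) _)

/-- A section of `E`, as a section of `⋀ E` of degree one. -/
def ofE (E : ModuleSheaf O) (U : Opens X) (s : E.sec U) : E.Ext U :=
  E.toExt U (ExteriorAlgebra.ι (secO O U) s)

theorem extRes_ofO (E : ModuleSheaf O) {U V : Opens X} (h : V ≤ U) (f : secO O U) :
    E.extRes h (E.ofO U f) = E.ofO V (resO O h f) :=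
  (E.extRes_toExt h _).trans (congrArg (E.toExt V) (extMap_algebraMap _ _ _ f))

theorem ofO_comm (E : ModuleSheaf O) (U : Opens X) (f : secO O U)
    (a : ExteriorAlgebra (secO O U) (E.sec U)) :
    E.ofO U f * E.toExt U a = E.toExt U (f • a) := by
  rw [Algebra.smul_def, map_mul]
  rfl

/-- `⋀ E` as a sheaf of `O`-modules. -/
def extModule (E : ModuleSheaf O) : ModuleSheaf O where
  sec U := E.Ext U
  addCommGroup _ := inferInstance
  moduleK _ := inferInstance
  moduleO U := Module.compHom (E.Ext U) (E.ofO U).toRingHom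
  isScalarTower U :=
    letI : Module (secO O U) (E.Ext U) := Module.compHom (E.Ext U) (E.ofO U).toRingHom
    ⟨fun c f s => by
      change E.ofO U (c • f) * s = c • (E.ofO U f * s)
      rw [map_smul, smul_mul_assoc]⟩
  res h := (E.extRes h).toLinearMap
  res_self {U} s := by
    change (E.extSheaf.obj.map (𝟙 (op U))).hom s = s
    rw [CategoryTheory.Functor.map_id]
    rfl
  res_res h h' s := by
    change (E.extSheaf.obj.map (homOfLE h).op ≫ E.extSheaf.obj.map (homOfLE h').op).hom s = _
    rw [← Functor.map_comp]
    rfl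
  res_smul h f s := by
    change E.extRes h (E.ofO _ f * s) = E.ofO _ (resO O h f) * E.extRes h s
    rw [map_mul, extRes_ofO]
  isSheaf := ((sheafCompose (Opens.grothendieckTopology X)
    (forget₂ (AlgCat.{u} K) (ModuleCat.{u} K))).obj E.extSheaf).property

/-- The submodule sheaf of `⋀ E` of the sections that are locally of degree `k`. -/
def extSub (E : ModuleSheaf O) (k : ℕ) : E.extModule.Sub where
  carrier U :=
    { carrier := {s | ∀ x ∈ U, ∃ (V : Opens X) (h : V ≤ U), x ∈ V ∧
        ∃ a ∈ ⋀[secO O V]^k (E.sec V), E.extRes h s = E.toExt V a}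
      zero_mem' := fun x hx => ⟨U, le_rfl, hx, 0, zero_mem _, by
        rw [map_zero]; exact map_zero (E.extRes le_rfl)⟩
      add_mem' := fun {s t} hs ht x hx => by
        obtain ⟨V, hV, hxV, a, ha, hsa⟩ := hs x hx
        obtain ⟨W, hW, hxW, b, hb, htb⟩ := ht x hx
        refine ⟨V ⊓ W, inf_le_left.trans hV, ⟨hxV, hxW⟩, _,
          add_mem (extMap_mem _ _ (E.res_smul inf_le_left) k ha)
            (extMap_mem _ _ (E.res_smul inf_le_right) k hb), ?_⟩
        rw [map_add, ← extRes_toExt, ← extRes_toExt, ← hsa, ← htb]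
        refine (map_add (E.extRes _) s t).trans ?_
        exact congrArg₂ (· + ·) (E.extModule.res_res hV inf_le_left s).symm
          (E.extModule.res_res hW inf_le_right t).symm
      smul_mem' := fun f s hs x hx => by
        obtain ⟨V, hV, hxV, a, ha, hsa⟩ := hs x hx
        refine ⟨V, hV, hxV, _, Submodule.smul_mem _ (resO O hV f) ha, ?_⟩
        refine (map_mul (E.extRes hV) (E.ofO U f) s).trans ?_
        rw [hsa, extRes_ofO, ofO_comm] }
  res_mem {U V} h s hs x hx := by
    obtain ⟨W, hW, hxW, a, ha, hsa⟩ := hs x (h hx)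
    refine ⟨V ⊓ W, inf_le_left, ⟨hx, hxW⟩, _,
      extMap_mem _ _ (E.res_smul inf_le_right) k ha, ?_⟩
    rw [← extRes_toExt, ← hsa]
    exact (E.extModule.res_res h inf_le_left s).trans
      (E.extModule.res_res hW inf_le_right s).symm
  local_mem {U} s hs x hx := by
    obtain ⟨V, hV, hxV, hsV⟩ := hs x hx
    obtain ⟨W, hW, hxW, a, ha, hsa⟩ := hsV x hxV
    exact ⟨W, hW.trans hV, hxW, a, ha, ((E.extModule.res_res hV hW s).symm).trans hsa⟩

/-- The sheaf of `O`-modules `⋀^k E`: the part of degree `k` of `⋀ E`. -/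
def extPow (E : ModuleSheaf O) (k : ℕ) : ModuleSheaf O :=
  (E.extSub k).toModuleSheaf

/-- The section `a` of `⋀ E` over `U` is homogeneous of degree `k`. -/
def HasDegree (E : ModuleSheaf O) (k : ℕ) {U : Opens X} (a : E.Ext U) : Prop :=
  a ∈ (E.extSub k).carrier U

/-- A section of `⋀^k E`, as a section of `⋀ E`. -/
def extIncl (E : ModuleSheaf O) (k : ℕ) (U : Opens X) : (E.extPow k).sec U →ₗ[K] E.Ext U where
  toFun s := (E.extSub k).val U s
  map_add' _ _ := rfl
  map_smul' _ _ := rfl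

theorem extIncl_hasDegree (E : ModuleSheaf O) (k : ℕ) {U : Opens X} (s : (E.extPow k).sec U) :
    E.HasDegree k (E.extIncl k U s) :=
  (E.extSub k).val_mem s

/-- A homogeneous section of `⋀ E` of degree `k`, as a section of `⋀^k E`. -/
def extMk (E : ModuleSheaf O) (k : ℕ) {U : Opens X} (a : E.Ext U) (ha : E.HasDegree k a) :
    (E.extPow k).sec U :=
  (E.extSub k).ofMem a ha

theorem extIncl_injective (E : ModuleSheaf O) (k : ℕ) (U : Opens X) :
    Function.Injective (E.extIncl k U) :=
  (E.extSub k).val_injective U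

theorem extIncl_extMk (E : ModuleSheaf O) (k : ℕ) {U : Opens X} (a : E.Ext U)
    (ha : E.HasDegree k a) : E.extIncl k U (E.extMk k a ha) = a :=
  rfl

theorem extIncl_res (E : ModuleSheaf O) (k : ℕ) {U V : Opens X} (h : V ≤ U)
    (s : (E.extPow k).sec U) :
    E.extIncl k V ((E.extPow k).res h s) = E.extRes h (E.extIncl k U s) :=
  rfl

namespace Hom

variable {E F : ModuleSheaf O}

/-- The homomorphism `⋀_{O(U)} E(U) → ⋀_{O(U)} F(U)` induced by a morphism of sheaves of modules. -/
def extAlgHom (φ : Hom E F) (U : Opens X) :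
    ExteriorAlgebra (secO O U) (E.sec U) →ₐ[K] ExteriorAlgebra (secO O U) (F.sec U) :=
  extMap (AlgHom.id K _) ((φ.app U).restrictScalars K) (fun r m => (φ.app U).map_smul r m)

/-- The morphism of presheaves of exterior algebras induced by a morphism of sheaves of modules. -/
def extPresheafMap (φ : Hom E F) : E.extPresheaf ⟶ F.extPresheaf where
  app U := AlgCat.ofHom (φ.extAlgHom U.unop)
  naturality {U V} i := AlgCat.hom_ext _ (extMap_comm
    (resO O i.unop.le) (E.res i.unop.le) (E.res_smul i.unop.le)
    (AlgHom.id K _) ((φ.app V.unop).restrictScalars K) (fun r m => (φ.app V.unop).map_smul r m)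
    (AlgHom.id K _) ((φ.app U.unop).restrictScalars K) (fun r m => (φ.app U.unop).map_smul r m)
    (resO O i.unop.le) (F.res i.unop.le) (F.res_smul i.unop.le)
    (fun _ => rfl) (fun m => φ.app_res i.unop.le m))

/-- The morphism `⋀ φ : ⋀ E ⟶ ⋀ F` of sheaves of algebras. -/
def extSheafMap (φ : Hom E F) : E.extSheaf ⟶ F.extSheaf :=
  (presheafToSheaf (Opens.grothendieckTopology X) (AlgCat.{u} K)).map φ.extPresheafMap

/-- `⋀ φ` on sections. -/
def ext (φ : Hom E F) (U : Opens X) : E.Ext U →ₐ[K] F.Ext U :=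
  (φ.extSheafMap.hom.app (op U)).hom

theorem ext_res (φ : Hom E F) {U V : Opens X} (h : V ≤ U) (a : E.Ext U) :
    φ.ext V (E.extRes h a) = F.extRes h (φ.ext U a) :=
  ConcreteCategory.congr_hom (φ.extSheafMap.hom.naturality (homOfLE h).op) a

theorem ext_toExt (φ : Hom E F) (U : Opens X) (a : ExteriorAlgebra (secO O U) (E.sec U)) :
    φ.ext U (E.toExt U a) = F.toExt U (φ.extAlgHom U a) := by
  have h := toSheafify_naturality (Opens.grothendieckTopology X) φ.extPresheafMap
  exact (ConcreteCategory.congr_hom (NatTrans.congr_app h (op U)) a).symm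

theorem ext_hasDegree (φ : Hom E F) (k : ℕ) {U : Opens X} {a : E.Ext U} (ha : E.HasDegree k a) :
    F.HasDegree k (φ.ext U a) := by
  intro x hx
  obtain ⟨V, hV, hxV, b, hb, hab⟩ := ha x hx
  refine ⟨V, hV, hxV, φ.extAlgHom V b,
    extMap_mem (AlgHom.id K _) ((φ.app V).restrictScalars K) _ k hb, ?_⟩
  rw [← ext_toExt, ← hab, ext_res]

/-- `⋀^k φ` on sections. -/
def pow (φ : Hom E F) (k : ℕ) (U : Opens X) : (E.extPow k).sec U →ₗ[K] (F.extPow k).sec U where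
  toFun s := F.extMk k (φ.ext U (E.extIncl k U s)) (φ.ext_hasDegree k (E.extIncl_hasDegree k s))
  map_add' s t := F.extIncl_injective k U (by
    simp only [map_add, extIncl_extMk])
  map_smul' c s := F.extIncl_injective k U (by
    simp only [map_smul, extIncl_extMk, RingHom.id_apply])

theorem pow_res (φ : Hom E F) (k : ℕ) {U V : Opens X} (h : V ≤ U) (s : (E.extPow k).sec U) :
    φ.pow k V ((E.extPow k).res h s) = (F.extPow k).res h (φ.pow k U s) :=
  F.extIncl_injective k V (φ.ext_res h (E.extIncl k U s))

/-- The morphism of sheaves `⋀^k φ : ⋀^k E ⟶ ⋀^k F`. -/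
def powHom (φ : Hom E F) (k : ℕ) : (E.extPow k).toSheaf ⟶ (F.extPow k).toSheaf :=
  ⟨{ app := fun U => ModuleCat.ofHom (φ.pow k U.unop)
     naturality := fun U V i => by
      ext s
      exact φ.pow_res k i.unop.le s }⟩

end Hom

end ModuleSheaf

/-! ### Lie algebroids -/

/-- A Lie algebroid over `(X, O)`: a sheaf of `O`-modules with a structure of sheaf of Lie algebras
over `K` and an anchor with values in the derivations of `O`, satisfying the Leibniz rule. A section
over `U` of the sheaf of derivations is a family of derivations of the `O(V)`, `V ⊆ U`, compatible
with restriction; the family attached to `D` is given by `anchor V (D|_V)`. -/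
structure LieAlgebroid (O : Sh X (CommAlgCat.{u} K)) extends ModuleSheaf O where
  bracket : ∀ U : Opens X, sec U →ₗ[K] sec U →ₗ[K] sec U
  bracket_self : ∀ {U : Opens X} (D : sec U), bracket U D D = 0
  jacobi : ∀ {U : Opens X} (D₁ D₂ D₃ : sec U),
    bracket U D₁ (bracket U D₂ D₃) + bracket U D₂ (bracket U D₃ D₁) +
      bracket U D₃ (bracket U D₁ D₂) = 0
  res_bracket : ∀ {U V : Opens X} (h : V ≤ U) (D₁ D₂ : sec U),
    res h (bracket U D₁ D₂) = bracket V (res h D₁) (res h D₂)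
  anchor : ∀ U : Opens X, sec U →ₗ[secO O U] Derivation K (secO O U) (secO O U)
  res_anchor : ∀ {U V : Opens X} (h : V ≤ U) (D : sec U) (f : secO O U),
    resO O h (anchor U D f) = anchor V (res h D) (resO O h f)
  anchor_bracket : ∀ {U : Opens X} (D₁ D₂ : sec U),
    anchor U (bracket U D₁ D₂) = ⁅anchor U D₁, anchor U D₂⁆
  bracket_smul : ∀ {U : Opens X} (D₁ : sec U) (f : secO O U) (D₂ : sec U),
    bracket U D₁ (f • D₂) = f • bracket U D₁ D₂ + anchor U D₁ f • D₂

namespace LieAlgebroid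

variable {O : Sh X (CommAlgCat.{u} K)}

/-- A morphism of Lie algebroids over `(X, O)`; it makes its source `L'` an `L`-Lie algebroid. -/
structure Hom (L' L : LieAlgebroid O) extends
    ModuleSheaf.Hom L'.toModuleSheaf L.toModuleSheaf where
  app_bracket : ∀ {U : Opens X} (D₁ D₂ : L'.sec U),
    app U (L'.bracket U D₁ D₂) = L.bracket U (app U D₁) (app U D₂)
  anchor_app : ∀ {U : Opens X} (D : L'.sec U), L.anchor U (app U D) = L'.anchor U D

/-- The Lie subalgebroid given by a submodule sheaf that is stable under the bracket. -/
def sub (L : LieAlgebroid O) (S : L.Sub) (hS : ∀ {U : Opens X} {D₁ D₂ : L.sec U},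
    D₁ ∈ S.carrier U → D₂ ∈ S.carrier U → L.bracket U D₁ D₂ ∈ S.carrier U) : LieAlgebroid O where
  toModuleSheaf := S.toModuleSheaf
  bracket U := LinearMap.mk₂ K
    (fun D₁ D₂ => S.ofMem (L.bracket U (S.val U D₁) (S.val U D₂)) (hS (S.val_mem D₁) (S.val_mem D₂)))
    (fun a b c => S.val_injective U (by
      change L.bracket U (S.val U (a + b)) (S.val U c) = L.bracket U _ _ + L.bracket U _ _
      simp))
    (fun r a b => S.val_injective U (by
      change L.bracket U (r • S.val U a) (S.val U b) = r • L.bracket U _ _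
      simp))
    (fun a b c => S.val_injective U (by
      change L.bracket U (S.val U a) (S.val U (b + c)) = L.bracket U _ _ + L.bracket U _ _
      simp))
    (fun r a b => S.val_injective U (by
      change L.bracket U (S.val U a) (r • S.val U b) = r • L.bracket U _ _
      simp))
  bracket_self {U} D := S.val_injective U (L.bracket_self (S.val U D))
  jacobi {U} D₁ D₂ D₃ := S.val_injective U (L.jacobi (S.val U D₁) (S.val U D₂) (S.val U D₃))
  res_bracket {U V} h D₁ D₂ := S.val_injective V (L.res_bracket h (S.val U D₁) (S.val U D₂))
  anchor U := (L.anchor U).comp (S.val U)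
  res_anchor {U V} h D f := L.res_anchor h (S.val U D) f
  anchor_bracket {U} D₁ D₂ := L.anchor_bracket (S.val U D₁) (S.val U D₂)
  bracket_smul {U} D₁ f D₂ := S.val_injective U (L.bracket_smul (S.val U D₁) f (S.val U D₂))

namespace Hom

variable {L' L : LieAlgebroid O}

/-- The image sheaf of a morphism of Lie algebroids: the sections that lie locally in the image. -/
def imageSub (φ : Hom L' L) : L.Sub where
  carrier U :=
    { carrier := {s | ∀ x ∈ U, ∃ (V : Opens X) (h : V ≤ U), x ∈ V ∧
        ∃ t : L'.sec V, φ.app V t = L.res h s}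
      zero_mem' := fun x hx => ⟨U, le_rfl, hx, 0, by rw [map_zero, map_zero]⟩
      add_mem' := fun {a b} ha hb x hx => by
        obtain ⟨V, hV, hxV, s, hs⟩ := ha x hx
        obtain ⟨W, hW, hxW, t, ht⟩ := hb x hx
        refine ⟨V ⊓ W, inf_le_left.trans hV, ⟨hxV, hxW⟩,
          L'.res inf_le_left s + L'.res inf_le_right t, ?_⟩
        rw [map_add, map_add, φ.app_res, φ.app_res, hs, ht, L.res_res, L.res_res]
      smul_mem' := fun f a ha x hx => by
        obtain ⟨V, hV, hxV, s, hs⟩ := ha x hx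
        exact ⟨V, hV, hxV, resO O hV f • s, by rw [map_smul, hs, L.res_smul]⟩ }
  res_mem {U V} h s hs x hx := by
    obtain ⟨W, hW, hxW, t, ht⟩ := hs x (h hx)
    exact ⟨V ⊓ W, inf_le_left, ⟨hx, hxW⟩, L'.res inf_le_right t, by
      rw [φ.app_res, ht, L.res_res, L.res_res]⟩
  local_mem {U} s hs x hx := by
    obtain ⟨V, hV, hxV, hsV⟩ := hs x hx
    obtain ⟨W, hW, hxW, t, ht⟩ := hsV x hxV
    exact ⟨W, hW.trans hV, hxW, t, by rw [ht, L.res_res]⟩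

/-- The image of a morphism of Lie algebroids, a Lie subalgebroid of the target. -/
def image (φ : Hom L' L) : LieAlgebroid O :=
  L.sub φ.imageSub fun {U} {D₁ D₂} h₁ h₂ x hx => by
    obtain ⟨V, hV, hxV, s, hs⟩ := h₁ x hx
    obtain ⟨W, hW, hxW, t, ht⟩ := h₂ x hx
    refine ⟨V ⊓ W, inf_le_left.trans hV, ⟨hxV, hxW⟩,
      L'.bracket _ (L'.res inf_le_left s) (L'.res inf_le_right t), ?_⟩
    rw [φ.app_bracket, φ.app_res, φ.app_res, hs, ht, L.res_res, L.res_res, L.res_bracket]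

/-- The map from the source to the image. -/
def toImage (φ : Hom L' L) (U : Opens X) (D : L'.sec U) : φ.image.sec U :=
  φ.imageSub.ofMem (φ.app U D) fun _ hx => ⟨U, le_rfl, hx, D, (L.res_self _).symm⟩

end Hom

/-! ### Connections -/

/-- An `L`-connection on the `O`-module `E`: an `O`-linear morphism from `L` to the Atiyah algebroid
of `E` over the anchor. As for the anchor, `∇ U D` determines an operator on `E|_U`, whose
component over `V ⊆ U` is `∇ V (D|_V)`. -/
@[ext]
structure Connection (L : LieAlgebroid O) (E : ModuleSheaf O) where
  toFun : ∀ U : Opens X, L.sec U →ₗ[secO O U] Module.End K (E.sec U)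
  res_toFun : ∀ {U V : Opens X} (h : V ≤ U) (D : L.sec U) (s : E.sec U),
    E.res h (toFun U D s) = toFun V (L.res h D) (E.res h s)
  leibniz : ∀ {U : Opens X} (D : L.sec U) (f : secO O U) (s : E.sec U),
    toFun U D (f • s) = f • toFun U D s + L.anchor U D f • s

namespace Connection

variable {L' L : LieAlgebroid O} {E : ModuleSheaf O}

/-- A connection is flat if its curvature vanishes. -/
def IsFlat (c : Connection L E) : Prop :=
  ∀ {U : Opens X} (D₁ D₂ : L.sec U) (s : E.sec U),
    c.toFun U (L.bracket U D₁ D₂) s =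
      c.toFun U D₁ (c.toFun U D₂ s) - c.toFun U D₂ (c.toFun U D₁ s)

/-- For an `L`-Lie algebroid `φ : L' → L`, an `L'`-connection on `E` is an `(L', L)`-connection if
it is the composite of `φ` with a connection on `E` of the Lie subalgebroid `Im φ` of `L`. -/
def IsRelative (φ : Hom L' L) (c : Connection L' E) : Prop :=
  ∃ c₀ : Connection φ.image E, ∀ (U : Opens X) (D : L'.sec U),
    c.toFun U D = c₀.toFun U (φ.toImage U D)

end Connection

/-! ### Generating operators and homology -/

/-- The bracket generated by an operator `Δ` on sections of the exterior algebra, for a first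
argument of degree `p`: `[a, b] = (-1)^p (Δ(a ∧ b) - Δa ∧ b - (-1)^p a ∧ Δb)`. -/
def generatedBracket {A : Type u} [Ring A] (Δ : A → A) (p : ℕ) (a b : A) : A :=
  (-1) ^ p * (Δ (a * b) - Δ a * b - (-1) ^ p * (a * Δ b))

/-- The generating operator of the Gerstenhaber algebra `⋀ L` that corresponds to an `L`-connection
`∇` on `⋀^n L`: an operator of degree `-1` and of square zero, such that the bracket generated by it
is a Gerstenhaber bracket (a biderivation of the wedge product, in the graded sense) which
extends the bracket and the anchor of `L`, and such that `∇_D Λ = - D ∧ Δ Λ`. (The graded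
antisymmetry of the generated bracket follows from its definition, its graded Jacobi identity
from `Δ² = 0`, and a Gerstenhaber bracket on `⋀ L` is determined by its values in degrees `≤ 1`, so
that the generated bracket is the Schouten-Nijenhuis bracket of `L`.) -/
@[ext]
structure GeneratingOperator {L : LieAlgebroid O} {n : ℕ} (c : Connection L (L.extPow n)) where
  toFun : ∀ U : Opens X, L.Ext U →ₗ[K] L.Ext U
  toFun_res : ∀ {U V : Opens X} (h : V ≤ U) (a : L.Ext U),
    toFun V (L.extRes h a) = L.extRes h (toFun U a)
  degree_zero : ∀ {U : Opens X} {a : L.Ext U}, L.HasDegree 0 a → toFun U a = 0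
  degree_succ : ∀ {U : Opens X} (k : ℕ) {a : L.Ext U}, L.HasDegree (k + 1) a →
    L.HasDegree k (toFun U a)
  sq_zero : ∀ {U : Opens X} (a : L.Ext U), toFun U (toFun U a) = 0
  bracket_mul : ∀ {U : Opens X} (p q : ℕ) {a b : L.Ext U} (e : L.Ext U),
    L.HasDegree p a → L.HasDegree q b →
    generatedBracket (toFun U) p a (b * e) =
      generatedBracket (toFun U) p a b * e +
        (-1) ^ ((p + 1) * q) * (b * generatedBracket (toFun U) p a e)
  bracket_section : ∀ {U : Opens X} (D₁ D₂ : L.sec U),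
    generatedBracket (toFun U) 1 (L.ofE U D₁) (L.ofE U D₂) = L.ofE U (L.bracket U D₁ D₂)
  bracket_function : ∀ {U : Opens X} (D : L.sec U) (f : secO O U),
    generatedBracket (toFun U) 1 (L.ofE U D) (L.ofO U f) = L.ofO U (L.anchor U D f)
  connection : ∀ {U : Opens X} (D : L.sec U) (s : (L.extPow n).sec U),
    L.extIncl n U (c.toFun U D s) = - (L.ofE U D * toFun U (L.extIncl n U s))

namespace GeneratingOperator

variable {L : LieAlgebroid O} {n : ℕ} {c : Connection L (L.extPow n)}

/-- The boundary `∂ = (-1)^(n-(k+1)) Δ : ⋀^(k+1) L → ⋀^k L` on sections; the sign is written as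
`(-1)^(n+k+1)`. -/
def boundarySec (Δ : GeneratingOperator c) (k : ℕ) (U : Opens X) :
    (L.extPow (k + 1)).sec U →ₗ[K] (L.extPow k).sec U where
  toFun s := (-1 : K) ^ (n + k + 1) •
    L.extMk k (Δ.toFun U (L.extIncl (k + 1) U s)) (Δ.degree_succ k (L.extIncl_hasDegree (k + 1) s))
  map_add' s t := L.extIncl_injective k U (by
    simp only [map_add, map_smul, ModuleSheaf.extIncl_extMk, smul_add])
  map_smul' r s := L.extIncl_injective k U (by
    simp only [map_smul, ModuleSheaf.extIncl_extMk, RingHom.id_apply]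
    rw [smul_comm])

theorem extIncl_boundarySec (Δ : GeneratingOperator c) (k : ℕ) (U : Opens X)
    (s : (L.extPow (k + 1)).sec U) : L.extIncl k U (Δ.boundarySec k U s) =
      (-1 : K) ^ (n + k + 1) • Δ.toFun U (L.extIncl (k + 1) U s) := by
  change L.extIncl k U ((-1 : K) ^ (n + k + 1) • L.extMk k _ _) = _
  rw [map_smul, ModuleSheaf.extIncl_extMk]

theorem boundarySec_res (Δ : GeneratingOperator c) (k : ℕ) {U V : Opens X} (h : V ≤ U)
    (s : (L.extPow (k + 1)).sec U) : Δ.boundarySec k V ((L.extPow (k + 1)).res h s) =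
      (L.extPow k).res h (Δ.boundarySec k U s) := by
  refine L.extIncl_injective k V ?_
  rw [extIncl_boundarySec, ModuleSheaf.extIncl_res, ModuleSheaf.extIncl_res, extIncl_boundarySec,
    Δ.toFun_res, map_smul]

theorem boundarySec_boundarySec (Δ : GeneratingOperator c) (k : ℕ) (U : Opens X)
    (s : (L.extPow (k + 1 + 1)).sec U) :
    Δ.boundarySec k U (Δ.boundarySec (k + 1) U s) = 0 := by
  refine L.extIncl_injective k U ?_
  rw [extIncl_boundarySec, extIncl_boundarySec, map_smul, Δ.sq_zero, smul_zero, smul_zero, map_zero]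

/-- The boundary as a morphism of sheaves of `K`-vector spaces. -/
def boundary (Δ : GeneratingOperator c) (k : ℕ) :
    (L.extPow (k + 1)).toSheaf ⟶ (L.extPow k).toSheaf :=
  ⟨{ app := fun U => ModuleCat.ofHom (Δ.boundarySec k U.unop)
     naturality := fun U V i => by
      ext s
      exact Δ.boundarySec_res k i.unop.le s }⟩

theorem boundary_comp (Δ : GeneratingOperator c) (k : ℕ) :
    Δ.boundary (k + 1) ≫ Δ.boundary k = 0 := by
  apply Sheaf.hom_ext
  ext U s
  exact Δ.boundarySec_boundarySec k U.unop s

/-- The chain complex of sheaves `(⋀^• L, ∂)`. -/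
def complex (Δ : GeneratingOperator c) : ChainComplex (Sh X (ModuleCat.{u} K)) ℕ :=
  ChainComplex.of (fun k => (L.extPow k).toSheaf) Δ.boundary Δ.boundary_comp

end GeneratingOperator

end LieAlgebroid

/-! ### Hyperhomology -/

section Hyper

variable (K X)

instance : HasDerivedCategory (Sh X (ModuleCat.{u} K)) := HasDerivedCategory.standard _

/-- The constant sheaf with value `K`. -/
def constK : Sh X (ModuleCat.{u} K) :=
  (constantSheaf (Opens.grothendieckTopology X) (ModuleCat.{u} K)).obj (ModuleCat.of K K)

variable {K X}

/-- A chain complex of sheaves as an object of the derived category, the term of degree `k` being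
placed in cohomological degree `-k`. -/
def toDerived : ChainComplex (Sh X (ModuleCat.{u} K)) ℕ ⥤ DerivedCategory (Sh X (ModuleCat.{u} K)) :=
  ComplexShape.embeddingDownNat.extendFunctor _ ⋙ DerivedCategory.Q

/-- The `k`-th hyperhomology of a chain complex `C` of sheaves of `K`-vector spaces: the cohomology
of degree `-k` of the derived global sections of `C`, that is, the `K`-vector space of
morphisms from the constant sheaf to `C[-k]` in the derived category. -/
def hyperhomology (C : ChainComplex (Sh X (ModuleCat.{u} K)) ℕ) (k : ℤ) : Type _ :=
  (DerivedCategory.singleFunctor (Sh X (ModuleCat.{u} K)) 0).obj (constK K X) ⟶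
    (shiftFunctor _ (-k)).obj (toDerived.obj C)

instance (C : ChainComplex (Sh X (ModuleCat.{u} K)) ℕ) (k : ℤ) :
    AddCommGroup (hyperhomology C k) :=
  inferInstanceAs (AddCommGroup (_ ⟶ _))

instance (C : ChainComplex (Sh X (ModuleCat.{u} K)) ℕ) (k : ℤ) :
    Module K (hyperhomology C k) :=
  inferInstanceAs (Module K (_ ⟶ _))

/-- The linear map induced on hyperhomology by a morphism of chain complexes of sheaves. -/
def hyperhomologyMap {C C' : ChainComplex (Sh X (ModuleCat.{u} K)) ℕ} (f : C ⟶ C') (k : ℤ) :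
    hyperhomology C k →ₗ[K] hyperhomology C' k :=
  Linear.rightComp K _ ((shiftFunctor _ (-k)).map (toDerived.map f))

end Hyper

end LieAlgd

end

/-! Everything is governed by a scalar function, the divergence. Write `L_D` for the Lie derivative
of `⋀ L` along a section `D`, the derivation extending the anchor and the bracket. On the line
bundle `⋀^n L` both `∇_D` and `L_D` obey the same Leibniz rule, so they differ by multiplication by
a function: `∇_D = L_D - δ(D)`. The linearity of `∇` in `D` becomes `δ(fD) = f δ(D) - D(f)`, and its
flatness becomes `δ[D, D'] = D(δ D') - D'(δ D)` (`exists_flatDivergence`).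

Conversely, such a `δ` defines an operator on `⋀ L` by `Δ(f) = 0` and `Δ(D ∧ a) = δ(D) a - D ∧ Δa -
L_D a`. The bracket it generates satisfies `[D, a] = L_D a`, and `Δ² = 0` because `[L_D, Δ]` is
contraction with `d(δ D)`. In top degree `D ∧ s = 0`, so the recursion reads `-D ∧ Δs = L_D s - δ(D)
s = ∇_D s`: this is the generating operator of `∇`. It is the only one: the Leibniz rule fixes `[D,
a]`, the value of `∇` in top degree fixes `Δ(D)`, and the formula for `[D, a]` then fixes `Δ` on all
products (`GeneratingOperator.toFun_eq_gen`).

A divergence pulls back along `φ` by composition, and the recursion shows that `⋀ φ` intertwines the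
two operators (`extMap_gen`, `Hom.ext_gen`). Hence the connection defined by `δ ∘ φ` is the required
`∇'`, it is flat, and `⋀ φ` is a morphism of complexes, to which hyperhomology is applied.
Uniqueness of `∇'` is injectivity of `⋀^n φ` (`Hom.pow_injective`), which rests on the fact that the
determinant of an injective square matrix over any commutative ring is not a zero divisor. Finally
`∇'` is relative because an injective `φ` identifies `L'` with its image sheaf. -/

noncomputable section

namespace LieAlgd

/-! ### Actions of an exterior algebra that are not linear over its scalars. -/

section EndLift

variable {K R M W : Type*} [Field K] [CommRing R] [Algebra K R] [AddCommGroup M] [Module K M]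
  [Module R M] [AddCommGroup W] [Module K W]

/-- The representation of an exterior algebra on a `K`-vector space given by commuting actions of
the scalars and of the generators. -/
def endLift (ρ : R →ₐ[K] Module.End K W) (μ : M →ₗ[K] Module.End K W)
    (hs : ∀ f m, μ (f • m) = ρ f * μ m) (hc : ∀ f m, μ m * ρ f = ρ f * μ m)
    (hq : ∀ m, μ m * μ m = 0) : ExteriorAlgebra R M →+* Module.End K W :=
  -- `Module.End K W` is not an `R`-algebra, since `ρ` need not have central image. In the
  -- centralizer of `ρ` it is central, and `hc` puts `μ` there, so the universal property applies
  -- over `R`.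
  let S : Subalgebra K (Module.End K W) := Subalgebra.centralizer K (Set.range ρ)
  letI : Algebra R S := RingHom.toAlgebra'
    (ρ.toRingHom.codRestrict S (fun f => by
      rintro _ ⟨g, rfl⟩
      change ρ g * ρ f = ρ f * ρ g
      rw [← map_mul, mul_comm, map_mul]))
    (fun f x => Subtype.ext (x.2 _ ⟨f, rfl⟩))
  let ν : M →ₗ[R] S :=
    { toFun := fun m => ⟨μ m, by rintro _ ⟨g, rfl⟩; exact (hc g m).symm⟩
      map_add' := fun a b => Subtype.ext (map_add μ a b)
      map_smul' := fun f m => by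
        rw [Algebra.smul_def]
        exact Subtype.ext (hs f m) }
  S.val.toRingHom.comp
    (ExteriorAlgebra.lift R ⟨ν, fun m => Subtype.ext (hq m)⟩).toRingHom

variable (ρ : R →ₐ[K] Module.End K W) (μ : M →ₗ[K] Module.End K W)
    (hs : ∀ f m, μ (f • m) = ρ f * μ m) (hc : ∀ f m, μ m * ρ f = ρ f * μ m)
    (hq : ∀ m, μ m * μ m = 0)

theorem endLift_algebraMap (f : R) : endLift ρ μ hs hc hq (algebraMap R _ f) = ρ f := by
  let S : Subalgebra K (Module.End K W) := Subalgebra.centralizer K (Set.range ρ)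
  let _ : Algebra R S := RingHom.toAlgebra'
    (ρ.toRingHom.codRestrict S (fun f => by
      rintro _ ⟨g, rfl⟩
      change ρ g * ρ f = ρ f * ρ g
      rw [← map_mul, mul_comm, map_mul]))
    (fun f x => Subtype.ext (x.2 _ ⟨f, rfl⟩))
  exact congrArg Subtype.val (AlgHom.commutes (ExteriorAlgebra.lift R (A := S) _) f)

theorem endLift_ι (m : M) : endLift ρ μ hs hc hq (ExteriorAlgebra.ι R m) = μ m := by
  let S : Subalgebra K (Module.End K W) := Subalgebra.centralizer K (Set.range ρ)
  let _ : Algebra R S := RingHom.toAlgebra'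
    (ρ.toRingHom.codRestrict S (fun f => by
      rintro _ ⟨g, rfl⟩
      change ρ g * ρ f = ρ f * ρ g
      rw [← map_mul, mul_comm, map_mul]))
    (fun f x => Subtype.ext (x.2 _ ⟨f, rfl⟩))
  exact congrArg Subtype.val (ExteriorAlgebra.lift_ι_apply R (A := S) _ _ m)

end EndLift

/-! ### Graded identities in exterior algebras, and operators defined by recursion. -/

section Algebra

variable {K : Type u} [Field K] {R M : Type u} [CommRing R] [Algebra K R] [AddCommGroup M]
  [Module K M] [Module R M] [IsScalarTower K R M]

/-- Induction on an element of an exterior algebra, adding generators on the left. -/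
theorem ext_induction {P : ExteriorAlgebra R M → Prop} (algebraMap : ∀ r : R, P (algebraMap R _ r))
    (add : ∀ x y, P x → P y → P (x + y)) (ι_mul : ∀ m x, P x → P (ExteriorAlgebra.ι R m * x))
    (a : ExteriorAlgebra R M) : P a :=
  CliffordAlgebra.left_induction _ algebraMap add (fun x m h => ι_mul m x h) a

theorem extPow_induction {P : ℕ → ExteriorAlgebra R M → Prop}
    (algebraMap : ∀ r : R, P 0 (algebraMap R _ r))
    (add : ∀ k x y, P k x → P k y → P k (x + y))
    (ι_mul : ∀ k m x, x ∈ ⋀[R]^k M → P k x → P (k + 1) (ExteriorAlgebra.ι R m * x)) (k : ℕ)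
    {a : ExteriorAlgebra R M} (ha : a ∈ ⋀[R]^k M) : P k a := by
  change a ∈ (LinearMap.range (ExteriorAlgebra.ι R) ^ k : Submodule R (ExteriorAlgebra R M)) at ha
  induction ha using Submodule.pow_induction_on_left' with
  | algebraMap r => exact algebraMap r
  | add x y i hx hy h₁ h₂ => exact add i x y h₁ h₂
  | mem_mul m hm i x hx h =>
    obtain ⟨m, rfl⟩ := hm
    exact ι_mul i m x hx h

theorem ι_mul_mem (m : M) (k : ℕ) {a : ExteriorAlgebra R M} (ha : a ∈ ⋀[R]^k M) :
    ExteriorAlgebra.ι R m * a ∈ ⋀[R]^(k + 1) M := by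
  change _ ∈ (LinearMap.range (ExteriorAlgebra.ι R) ^ (k + 1) : Submodule R _)
  rw [pow_succ']
  exact Submodule.mul_mem_mul ⟨m, rfl⟩ ha

theorem algebraMap_mem_extPow (r : R) : algebraMap R (ExteriorAlgebra R M) r ∈ ⋀[R]^0 M := by
  change _ ∈ (LinearMap.range (ExteriorAlgebra.ι R) ^ 0 : Submodule R _)
  rw [pow_zero]
  exact Submodule.algebraMap_mem _

theorem exists_algebraMap_of_mem {a : ExteriorAlgebra R M} (ha : a ∈ ⋀[R]^0 M) :
    ∃ r : R, a = algebraMap R _ r := by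
  change a ∈ (LinearMap.range (ExteriorAlgebra.ι R) ^ 0 : Submodule R _) at ha
  rw [pow_zero, Submodule.mem_one] at ha
  obtain ⟨r, rfl⟩ := ha
  exact ⟨r, rfl⟩

theorem ι_mul_swap (m m' : M) (a : ExteriorAlgebra R M) :
    ExteriorAlgebra.ι R m * (ExteriorAlgebra.ι R m' * a) =
      -(ExteriorAlgebra.ι R m' * (ExteriorAlgebra.ι R m * a)) := by
  rw [← mul_assoc, ← mul_assoc, ← neg_mul,
    eq_neg_of_add_eq_zero_left (ExteriorAlgebra.ι_add_mul_swap m m')]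

theorem mul_ι_of_mem (m : M) (k : ℕ) {a : ExteriorAlgebra R M} (ha : a ∈ ⋀[R]^k M) :
    a * ExteriorAlgebra.ι R m = (-1) ^ k * (ExteriorAlgebra.ι R m * a) := by
  refine extPow_induction (P := fun k a =>
    a * ExteriorAlgebra.ι R m = (-1) ^ k * (ExteriorAlgebra.ι R m * a)) ?_ ?_ ?_ k ha
  · intro r
    rw [pow_zero, one_mul, Algebra.commutes]
  · intro k x y hx hy
    rw [add_mul, hx, hy, mul_add, mul_add]
  · intro k m' x _ hx
    rw [mul_assoc, hx, ι_mul_swap m, pow_succ]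
    rcases neg_one_pow_eq_or (ExteriorAlgebra R M) k with h | h <;> rw [h] <;> simp

theorem mul_comm_of_mem (p q : ℕ) {a b : ExteriorAlgebra R M} (ha : a ∈ ⋀[R]^p M)
    (hb : b ∈ ⋀[R]^q M) : a * b = (-1) ^ (p * q) * (b * a) := by
  refine extPow_induction (P := fun p a => a * b = (-1) ^ (p * q) * (b * a)) ?_ ?_ ?_ p ha
  · intro r
    rw [zero_mul, pow_zero, one_mul, Algebra.commutes]
  · intro k x y hx hy
    rw [add_mul, hx, hy, mul_add, mul_add]
  · intro k m x _ hx
    rw [mul_assoc, hx, ← mul_assoc b, mul_ι_of_mem m q hb, add_mul, one_mul, pow_add]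
    rcases neg_one_pow_eq_or (ExteriorAlgebra R M) (k * q) with h | h <;>
      rcases neg_one_pow_eq_or (ExteriorAlgebra R M) q with h' | h' <;> rw [h, h'] <;>
      simp [mul_assoc]

/-- Operators `T` on an exterior algebra such that `T (f a) = f T a + P f a` and
`T (m ∧ a) = ε m ∧ T a + Q m a`. -/
structure ExtOpData (K R M : Type u) [Field K] [CommRing R] [Algebra K R] [AddCommGroup M]
    [Module K M] [Module R M] [IsScalarTower K R M] where
  ε : K
  P : R →ₗ[K] Module.End K (ExteriorAlgebra R M)
  Q : M →ₗ[K] Module.End K (ExteriorAlgebra R M)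
  -- These four fields are the consistency conditions of the recursion: they compare the two ways of
  -- computing `T` on `(fg)a`, on `(fm) ∧ a = f(m ∧ a)`, on `f(m ∧ a) = m ∧ (fa)`, and on `m ∧ m ∧ a
  -- = 0`.
  P_mul : ∀ f g a, P (f * g) a = f • P g a + P f (g • a)
  Q_smul : ∀ (f : R) (m : M) a, Q (f • m) a = f • Q m a + P f (ExteriorAlgebra.ι R m * a)
  comm : ∀ (f : R) (m : M) a, f • Q m a + P f (ExteriorAlgebra.ι R m * a) =
    ε • (ExteriorAlgebra.ι R m * P f a) + Q m (f • a)
  sq : ∀ (m : M) a, ε • (ExteriorAlgebra.ι R m * Q m a) + Q m (ExteriorAlgebra.ι R m * a) = 0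

namespace ExtOpData

variable (t : ExtOpData K R M)

theorem P_one : t.P 1 = 0 := by
  ext a
  have := t.P_mul 1 1 a
  simpa using this

/-- The action of the scalars on pairs `(a, T a)`. -/
def scalarAction : R →ₐ[K] Module.End K (ExteriorAlgebra R M × ExteriorAlgebra R M) :=
  AlgHom.ofLinearMap
    { toFun := fun f =>
        { toFun := fun x => (f • x.1, f • x.2 + t.P f x.1)
          map_add' := fun x y => by ext1 <;> simp; abel
          map_smul' := fun c x => by ext1 <;> simp [smul_comm c f] }
      map_add' := fun f g => by
        refine LinearMap.ext fun x => ?_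
        ext1 <;> simp [add_smul]; abel
      map_smul' := fun c f => by
        refine LinearMap.ext fun x => ?_
        ext1 <;> simp }
    (by refine LinearMap.ext fun x => ?_; ext1 <;> simp [P_one])
    (fun f g => by refine LinearMap.ext fun x => ?_; ext1 <;> simp [mul_smul, t.P_mul, add_assoc])

/-- The action of the generators on pairs `(a, T a)`. -/
def genAction : M →ₗ[K] Module.End K (ExteriorAlgebra R M × ExteriorAlgebra R M) where
  toFun m :=
    { toFun := fun x =>
        (ExteriorAlgebra.ι R m * x.1, t.ε • (ExteriorAlgebra.ι R m * x.2) + t.Q m x.1)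
      map_add' := fun x y => by ext1 <;> simp [mul_add]; abel
      map_smul' := fun c x => by ext1 <;> simp [smul_comm c t.ε] }
  map_add' m m' := by
    refine LinearMap.ext fun x => ?_
    ext1 <;> simp [add_mul]; abel
  map_smul' c m := by
    have : ExteriorAlgebra.ι R (c • m) = c • ExteriorAlgebra.ι R m :=
      ((ExteriorAlgebra.ι R).restrictScalars K).map_smul c m
    refine LinearMap.ext fun x => ?_
    ext1 <;> simp [this, smul_comm c t.ε]

/-- The action of the exterior algebra on pairs `(a, T a)`. -/
def action : ExteriorAlgebra R M →+*
    Module.End K (ExteriorAlgebra R M × ExteriorAlgebra R M) :=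
  -- The three obligations are `Q_smul`, `comm` and `sq`; `P_mul` has already made the scalars act
  -- multiplicatively.
  endLift t.scalarAction t.genAction
    (fun f m => by
      refine LinearMap.ext fun x => ?_
      ext1 <;> simp [scalarAction, genAction, t.Q_smul, smul_comm f t.ε, add_assoc])
    (fun f m => by
      refine LinearMap.ext fun x => ?_
      ext1 <;> simp [scalarAction, genAction, smul_comm f t.ε, add_assoc, t.comm, mul_add])
    (fun m => by
      refine LinearMap.ext fun x => ?_
      ext1
      · simp [genAction, ← mul_assoc]
      · simp [genAction, mul_add, ← mul_assoc, t.sq])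

/-- The operator defined by the data. -/
def op : Module.End K (ExteriorAlgebra R M) where
  -- The starting pair `(1, 0)` encodes the normalization `T 1 = 0`.
  toFun a := (t.action a (1, 0)).2
  map_add' a b := by simp
  map_smul' c a := by
    rw [← algebraMap_smul R c a, Algebra.smul_def, map_mul, action, endLift_algebraMap,
      AlgHom.commutes]
    rfl

theorem op_algebraMap (f : R) : t.op (algebraMap R _ f) = t.P f 1 := by
  change (t.action _ (1, 0)).2 = _
  simp [action, endLift_algebraMap, scalarAction]

/-- The orbit of `(1, 0)` is the graph of the operator. Both recursion rules `op_smul` and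
`op_ι_mul` are read off from it by acting once more. -/
theorem action_one (a : ExteriorAlgebra R M) : t.action a (1, 0) = (a, t.op a) := by
  refine Prod.ext ?_ rfl
  induction a using ext_induction with
  | algebraMap r =>
    rw [action, endLift_algebraMap, Algebra.algebraMap_eq_smul_one]; rfl
  | add x y hx hy => simp [hx, hy]
  | ι_mul m x hx =>
    rw [map_mul, Module.End.mul_apply]
    conv_lhs => rw [action, endLift_ι]
    exact congrArg (ExteriorAlgebra.ι R m * ·) hx

theorem op_smul (f : R) (a : ExteriorAlgebra R M) : t.op (f • a) = f • t.op a + t.P f a := by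
  change (t.action _ (1, 0)).2 = _
  rw [Algebra.smul_def, map_mul, Module.End.mul_apply, action_one]
  rw [action, endLift_algebraMap]
  rfl

theorem op_ι_mul (m : M) (a : ExteriorAlgebra R M) : t.op (ExteriorAlgebra.ι R m * a) =
    t.ε • (ExteriorAlgebra.ι R m * t.op a) + t.Q m a := by
  change (t.action _ (1, 0)).2 = _
  rw [map_mul, Module.End.mul_apply, action_one]
  rw [action, endLift_ι]
  rfl

end ExtOpData

end Algebra

/-! ### Lie derivatives and contractions on the exterior algebra of a Lie-Rinehart algebra. -/

section LieRinehart

open scoped CliffordAlgebra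

variable {K : Type u} [Field K] {R M : Type u} [CommRing R] [Algebra K R] [AddCommGroup M]
  [Module K M] [Module R M] [IsScalarTower K R M]

/-- A Lie-Rinehart structure on the `R`-module `M`: the algebra of a Lie algebroid on the sections
over an open set. -/
structure LieRinehartData (K R M : Type u) [Field K] [CommRing R] [Algebra K R] [AddCommGroup M]
    [Module K M] [Module R M] [IsScalarTower K R M] where
  bracket : M →ₗ[K] M →ₗ[K] M
  bracket_self : ∀ m, bracket m m = 0
  jacobi : ∀ a b c, bracket a (bracket b c) + bracket b (bracket c a) + bracket c (bracket a b) = 0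
  anchor : M →ₗ[R] Derivation K R R
  anchor_bracket : ∀ a b, anchor (bracket a b) = ⁅anchor a, anchor b⁆
  bracket_smul : ∀ (a : M) (f : R) (b : M),
    bracket a (f • b) = f • bracket a b + anchor a f • b

namespace LieRinehartData

variable (L : LieRinehartData K R M)

theorem bracket_swap (a b : M) : L.bracket a b = -L.bracket b a := by
  have h := L.bracket_self (a + b)
  simp only [map_add, LinearMap.add_apply, L.bracket_self, zero_add, add_zero] at h
  exact eq_neg_of_add_eq_zero_right h

theorem bracket_bracket (a b c : M) : L.bracket (L.bracket a b) c =
    L.bracket a (L.bracket b c) - L.bracket b (L.bracket a c) := by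
  have h := L.jacobi a b c
  rw [L.bracket_swap c a, L.bracket_swap c (L.bracket a b), map_neg] at h
  rw [eq_comm, ← sub_eq_zero, ← h]
  abel

theorem smul_bracket (f : R) (a b : M) :
    L.bracket (f • a) b = f • L.bracket a b - L.anchor b f • a := by
  rw [L.bracket_swap, L.bracket_smul, L.bracket_swap b a, smul_neg]
  abel

/-- The differential of a function, as a linear form. -/
def diff (f : R) : Module.Dual R M where
  toFun m := L.anchor m f
  map_add' a b := by simp
  map_smul' r a := by simp

theorem diff_add (f g : R) : L.diff (f + g) = L.diff f + L.diff g := by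
  ext m
  simp [diff]

theorem diff_mul (f g : R) : L.diff (f * g) = f • L.diff g + g • L.diff f := by
  ext m
  simp [diff]

theorem diff_smul (c : K) (f : R) (m : M) : L.diff (c • f) m = c • L.diff f m := by
  simp [diff]

/-- Contraction with the differential of a function. -/
def contract : R →ₗ[K] Module.End K (ExteriorAlgebra R M) where
  toFun f :=
    (CliffordAlgebra.contractLeft (Q := (0 : QuadraticForm R M)) (L.diff f)).restrictScalars K
  map_add' f g := by
    rw [diff_add, map_add]
    rfl
  map_smul' c f := by
    have : L.diff (c • f) = algebraMap K R c • L.diff f := by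
      ext m
      rw [diff_smul]
      exact Algebra.smul_def _ _
    rw [this, map_smul]
    ext a
    exact algebraMap_smul R c _

theorem contract_algebraMap (f r : R) : L.contract f (algebraMap R _ r) = 0 :=
  CliffordAlgebra.contractLeft_algebraMap _ _ _

theorem contract_one (f : R) : L.contract f 1 = 0 :=
  CliffordAlgebra.contractLeft_one _ _

theorem contract_smul (f r : R) (a : ExteriorAlgebra R M) :
    L.contract f (r • a) = r • L.contract f a :=
  map_smul (CliffordAlgebra.contractLeft (Q := (0 : QuadraticForm R M)) (L.diff f)) r a

theorem contract_ι_mul (f : R) (m : M) (a : ExteriorAlgebra R M) :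
    L.contract f (ExteriorAlgebra.ι R m * a) =
      L.anchor m f • a - ExteriorAlgebra.ι R m * L.contract f a :=
  CliffordAlgebra.contractLeft_ι_mul _ _ _

theorem contract_mul (f g : R) (a : ExteriorAlgebra R M) :
    L.contract (f * g) a = f • L.contract g a + g • L.contract f a := by
  change CliffordAlgebra.contractLeft (L.diff (f * g)) a = _
  rw [diff_mul, map_add, map_smul, map_smul]
  rfl

theorem contract_mul_of_mem (f : R) (q : ℕ) {b : ExteriorAlgebra R M} (e : ExteriorAlgebra R M)
    (hb : b ∈ ⋀[R]^q M) :
    L.contract f (b * e) = L.contract f b * e + (-1) ^ q * (b * L.contract f e) := by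
  refine extPow_induction (P := fun q b =>
    L.contract f (b * e) = L.contract f b * e + (-1) ^ q * (b * L.contract f e)) (fun r => ?_)
    (fun k x y hx hy => ?_) (fun k m x _ h => ?_) q hb
  · rw [← Algebra.smul_def, contract_smul, contract_algebraMap, ← Algebra.smul_def]
    simp
  · simp only [add_mul, map_add, hx, hy, mul_add]
    abel
  · rw [mul_assoc, contract_ι_mul, contract_ι_mul, h, pow_succ]
    rcases neg_one_pow_eq_or (ExteriorAlgebra R M) k with h | h <;> rw [h] <;>
      simp only [one_mul, neg_mul, mul_neg, neg_neg, sub_mul, smul_mul_assoc, mul_add,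
        mul_assoc] <;> abel

/-- The data defining the Lie derivative. -/
def lieDerData (D : M) : ExtOpData K R M where
  ε := 1
  P :=
    (Algebra.lsmul K K (ExteriorAlgebra R M)).toLinearMap ∘ₗ (L.anchor D : R →ₗ[K] R)
  Q :=
    { toFun := fun m => LinearMap.mulLeft K (ExteriorAlgebra.ι R (L.bracket D m))
      map_add' := fun f g => by ext a; simp [add_mul]
      map_smul' := fun c f => by ext a; simp }
  P_mul f g a := by
    change L.anchor D (f * g) • a = f • (L.anchor D g • a) + L.anchor D f • (g • a)
    rw [Derivation.leibniz, add_smul, smul_eq_mul, smul_eq_mul, mul_smul, mul_comm g, mul_smul]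
  Q_smul f m a := by
    simp [L.bracket_smul, add_mul]
  comm f m a := by
    simp
    abel
  sq m a := by
    simp [← mul_assoc, ← add_mul, ExteriorAlgebra.ι_add_mul_swap]

theorem lieDerData_ε (D : M) : (L.lieDerData D).ε = 1 := rfl

theorem lieDerData_P (D : M) (f : R) (a : ExteriorAlgebra R M) :
    (L.lieDerData D).P f a = L.anchor D f • a := rfl

theorem lieDerData_Q (D m : M) (a : ExteriorAlgebra R M) :
    (L.lieDerData D).Q m a = ExteriorAlgebra.ι R (L.bracket D m) * a := rfl

theorem lieDerOp_algebraMap (D : M) (f : R) :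
    (L.lieDerData D).op (algebraMap R _ f) = algebraMap R _ (L.anchor D f) := by
  rw [ExtOpData.op_algebraMap, lieDerData_P, Algebra.algebraMap_eq_smul_one]

theorem lieDerOp_smul (D : M) (f : R) (a : ExteriorAlgebra R M) :
    (L.lieDerData D).op (f • a) = f • (L.lieDerData D).op a + L.anchor D f • a := by
  rw [ExtOpData.op_smul, lieDerData_P]

theorem lieDerOp_ι_mul (D m : M) (a : ExteriorAlgebra R M) :
    (L.lieDerData D).op (ExteriorAlgebra.ι R m * a) =
      ExteriorAlgebra.ι R m * (L.lieDerData D).op a + ExteriorAlgebra.ι R (L.bracket D m) * a := by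
  rw [ExtOpData.op_ι_mul, lieDerData_ε, one_smul, lieDerData_Q]

/-- The Lie derivative on the exterior algebra. -/
def lieDer : M →ₗ[K] Module.End K (ExteriorAlgebra R M) where
  toFun D := (L.lieDerData D).op
  map_add' D D' := by
    refine LinearMap.ext fun a => ?_
    induction a using ext_induction with
    | algebraMap r => simp [lieDerOp_algebraMap]
    | add x y hx hy => simp only [map_add, hx, hy]
    | ι_mul m x hx =>
      simp only [LinearMap.add_apply] at hx
      simp only [LinearMap.add_apply, lieDerOp_ι_mul, hx, map_add, mul_add, add_mul]
      abel
  map_smul' c D := by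
    refine LinearMap.ext fun a => ?_
    induction a using ext_induction with
    | algebraMap r =>
      simp only [lieDerOp_algebraMap, LinearMap.smul_apply, RingHom.id_apply,
        LinearMap.map_smul_of_tower, Derivation.smul_apply]
      rw [← algebraMap_smul R c (algebraMap R (ExteriorAlgebra R M) _),
        Algebra.smul_def c, map_mul, Algebra.smul_def]
    | add x y hx hy => simp only [map_add, hx, hy]
    | ι_mul m x hx =>
      simp only [LinearMap.smul_apply, RingHom.id_apply] at hx
      simp [lieDerOp_ι_mul, hx]

theorem lieDer_algebraMap (D : M) (f : R) :
    L.lieDer D (algebraMap R _ f) = algebraMap R _ (L.anchor D f) :=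
  L.lieDerOp_algebraMap D f

theorem lieDer_one (D : M) : L.lieDer D 1 = 0 := by
  simpa using L.lieDer_algebraMap D 1

theorem lieDer_smul (D : M) (f : R) (a : ExteriorAlgebra R M) :
    L.lieDer D (f • a) = f • L.lieDer D a + L.anchor D f • a :=
  L.lieDerOp_smul D f a

theorem lieDer_ι_mul (D m : M) (a : ExteriorAlgebra R M) :
    L.lieDer D (ExteriorAlgebra.ι R m * a) =
      ExteriorAlgebra.ι R m * L.lieDer D a + ExteriorAlgebra.ι R (L.bracket D m) * a :=
  L.lieDerOp_ι_mul D m a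

theorem lieDer_ι (D m : M) :
    L.lieDer D (ExteriorAlgebra.ι R m) = ExteriorAlgebra.ι R (L.bracket D m) := by
  have h := L.lieDer_ι_mul D m 1
  rwa [lieDer_one, mul_zero, zero_add, mul_one, mul_one] at h

theorem lieDer_mul (D : M) (a b : ExteriorAlgebra R M) :
    L.lieDer D (a * b) = L.lieDer D a * b + a * L.lieDer D b := by
  induction a using ext_induction with
  | algebraMap r =>
    rw [← Algebra.smul_def, lieDer_smul, lieDer_algebraMap, ← Algebra.smul_def, ← Algebra.smul_def,
      add_comm]
  | add x y hx hy => simp only [map_add, add_mul, hx, hy]; abel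
  | ι_mul m x hx =>
    rw [mul_assoc, lieDer_ι_mul, lieDer_ι_mul, hx]
    simp only [mul_add, add_mul, mul_assoc]
    abel

theorem lieDer_mem (D : M) (k : ℕ) {a : ExteriorAlgebra R M} (ha : a ∈ ⋀[R]^k M) :
    L.lieDer D a ∈ ⋀[R]^k M := by
  refine extPow_induction (P := fun k a => L.lieDer D a ∈ ⋀[R]^k M) (fun r => ?_)
    (fun k x y hx hy => ?_) (fun k m x hx h => ?_) k ha
  · rw [lieDer_algebraMap]
    exact algebraMap_mem_extPow _
  · rw [map_add]
    exact add_mem hx hy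
  · rw [lieDer_ι_mul]
    exact add_mem (ι_mul_mem _ _ h) (ι_mul_mem _ _ hx)

/-- The Lie derivative is not linear in `D`, because `[fD, m] = f[D, m] - m(f) D`; the correction
spreads over a product as `D` wedged with the contraction by `df`. This term is what forces `Δ(fa) =
fΔa - i_{df} a` and the non-linear rule for a divergence. -/
theorem smul_lieDer (f : R) (D : M) (a : ExteriorAlgebra R M) :
    L.lieDer (f • D) a = f • L.lieDer D a - ExteriorAlgebra.ι R D * L.contract f a := by
  induction a using ext_induction with
  | algebraMap r => simp [lieDer_algebraMap, contract_algebraMap, Algebra.smul_def]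
  | add x y hx hy => simp only [map_add, hx, hy, smul_add, mul_add]; abel
  | ι_mul m x hx =>
    rw [lieDer_ι_mul, lieDer_ι_mul, contract_ι_mul, hx, L.smul_bracket, map_sub, map_smul, map_smul]
    simp only [mul_sub, sub_mul, smul_mul_assoc, mul_smul_comm, smul_add, ι_mul_swap D m]
    abel

theorem lieDer_bracket (D D' : M) (a : ExteriorAlgebra R M) :
    L.lieDer (L.bracket D D') a = L.lieDer D (L.lieDer D' a) - L.lieDer D' (L.lieDer D a) := by
  induction a using ext_induction with
  | algebraMap r =>
    simp only [lieDer_algebraMap, L.anchor_bracket, Derivation.commutator_apply, map_sub]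
  | add x y hx hy => simp only [map_add, hx, hy]; abel
  | ι_mul m x hx =>
    simp only [lieDer_ι_mul, hx, map_add, L.bracket_bracket, map_sub, mul_sub, sub_mul]
    abel

/-! ### The generating operator of a flat divergence. -/

/-- A flat divergence on a Lie-Rinehart algebra. -/
structure Divergence where
  toFun : M →ₗ[K] R
  map_smul : ∀ (f : R) (D : M), toFun (f • D) = f * toFun D - L.anchor D f
  map_bracket : ∀ D D', toFun (L.bracket D D') = L.anchor D (toFun D') - L.anchor D' (toFun D)

variable {L} (δ : L.Divergence)

namespace Divergence

/-- The data defining the generating operator of a divergence. -/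
def extOpData : ExtOpData K R M where
  -- The data encode `Δ(fa) = fΔa - i_{df} a` and `Δ(m ∧ a) = -m ∧ Δa + δ(m) a - L_m a`.
  ε := -1
  P := -L.contract
  Q :=
    (Algebra.lsmul K K (ExteriorAlgebra R M)).toLinearMap ∘ₗ δ.toFun - L.lieDer
  P_mul f g a := by
    simp [contract_mul, contract_smul]
    abel
  Q_smul f m a := by
    simp [δ.map_smul, smul_lieDer, contract_ι_mul, smul_sub]
    abel
  comm f m a := by
    simp [contract_ι_mul, smul_sub, lieDer_smul, smul_smul, mul_comm]
    abel
  sq m a := by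
    simp [lieDer_ι_mul, L.bracket_self, mul_sub]

/-- The generating operator of a divergence. -/
def gen : Module.End K (ExteriorAlgebra R M) := δ.extOpData.op

theorem gen_algebraMap (f : R) : δ.gen (algebraMap R _ f) = 0 := by
  rw [gen, ExtOpData.op_algebraMap]
  simp [extOpData, contract_one]

theorem gen_one : δ.gen 1 = 0 := by
  simpa using δ.gen_algebraMap 1

theorem gen_smul (f : R) (a : ExteriorAlgebra R M) :
    δ.gen (f • a) = f • δ.gen a - L.contract f a := by
  rw [gen, ExtOpData.op_smul]
  simp [extOpData, sub_eq_add_neg]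

theorem gen_ι_mul (m : M) (a : ExteriorAlgebra R M) :
    δ.gen (ExteriorAlgebra.ι R m * a) =
      δ.toFun m • a - ExteriorAlgebra.ι R m * δ.gen a - L.lieDer m a := by
  rw [gen, ExtOpData.op_ι_mul]
  simp [extOpData]
  abel

theorem gen_ι (m : M) : δ.gen (ExteriorAlgebra.ι R m) = algebraMap R _ (δ.toFun m) := by
  have h := δ.gen_ι_mul m 1
  rw [lieDer_one, gen_one] at h
  simpa [Algebra.algebraMap_eq_smul_one] using h

theorem gen_mem (k : ℕ) {a : ExteriorAlgebra R M} (ha : a ∈ ⋀[R]^(k + 1) M) :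
    δ.gen a ∈ ⋀[R]^k M := by
  -- The vanishing in degree zero has to be carried along: the term `m ∧ Δx` has the right degree
  -- for `x` of degree zero only because `Δx = 0`.
  refine (extPow_induction (P := fun k a => (∀ j, k = j + 1 → δ.gen a ∈ ⋀[R]^j M) ∧
    (k = 0 → δ.gen a = 0)) (fun r => ?_) (fun k x y hx hy => ?_) (fun k m x hx h => ?_) (k + 1)
    ha).1 k rfl
  · exact ⟨fun j hj => by omega, fun _ => δ.gen_algebraMap r⟩
  · refine ⟨fun j hj => ?_, fun hk => ?_⟩
    · rw [map_add]
      exact add_mem (hx.1 j hj) (hy.1 j hj)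
    · rw [map_add, hx.2 hk, hy.2 hk, add_zero]
  · refine ⟨fun j hj => ?_, fun hk => by omega⟩
    obtain rfl : k = j := by omega
    rw [gen_ι_mul]
    refine sub_mem (sub_mem (Submodule.smul_mem _ _ hx) ?_) (L.lieDer_mem m k hx)
    cases k with
    | zero =>
      rw [h.2 rfl, mul_zero]
      exact zero_mem _
    | succ k => exact ι_mul_mem m k (h.1 k rfl)

/-- The commutator `[L_D, Δ]` is contraction with `d(δ D)`. On `m ∧ x` the discrepancy in the
coefficient of `x` is `D(δ m) - δ[D, m]`, which `map_bracket` turns into `m(δ D)`, as the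
contraction demands. -/
theorem lieDer_gen (D : M) (a : ExteriorAlgebra R M) :
    L.lieDer D (δ.gen a) = δ.gen (L.lieDer D a) + L.contract (δ.toFun D) a := by
  induction a using ext_induction with
  | algebraMap r => simp [gen_algebraMap, contract_algebraMap, lieDer_algebraMap]
  | add x y hx hy => simp only [map_add, hx, hy]; abel
  | ι_mul m x hx =>
    simp only [gen_ι_mul, contract_ι_mul, map_sub, map_add, hx, lieDer_ι_mul, lieDer_smul,
      δ.map_bracket, L.lieDer_bracket, mul_add, sub_smul]
    abel

/-- Applying the recursion twice to `m ∧ x` leaves `m ∧ Δ²x + [L_m, Δ]x - i_{d(δ m)} x`, so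
`lieDer_gen` and induction conclude. -/
theorem gen_gen (a : ExteriorAlgebra R M) : δ.gen (δ.gen a) = 0 := by
  induction a using ext_induction with
  | algebraMap r => simp [gen_algebraMap]
  | add x y hx hy => simp only [map_add, hx, hy, add_zero]
  | ι_mul m x hx =>
    simp only [gen_ι_mul, map_sub, gen_smul, hx, mul_zero, lieDer_gen]
    abel

theorem generatedBracket_ι (D : M) (a : ExteriorAlgebra R M) :
    LieAlgebroid.generatedBracket δ.gen 1 (ExteriorAlgebra.ι R D) a = L.lieDer D a := by
  rw [LieAlgebroid.generatedBracket, gen_ι_mul, gen_ι, ← Algebra.smul_def]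
  simp
  abel

theorem generatedBracket_algebraMap (f : R) (a : ExteriorAlgebra R M) :
    LieAlgebroid.generatedBracket δ.gen 0 (algebraMap R _ f) a = -L.contract f a := by
  rw [LieAlgebroid.generatedBracket, ← Algebra.smul_def, gen_smul, gen_algebraMap,
    ← Algebra.smul_def]
  simp

/-- Leibniz rule in the first argument; it allows the derivation property in the second argument to
be proved by induction on the first, starting from contractions in degree zero. -/
theorem generatedBracket_ι_mul (D : M) (p : ℕ) (a b : ExteriorAlgebra R M) :
    LieAlgebroid.generatedBracket δ.gen (p + 1) (ExteriorAlgebra.ι R D * a) b =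
      ExteriorAlgebra.ι R D * LieAlgebroid.generatedBracket δ.gen p a b +
        (-1) ^ p * (a * L.lieDer D b) := by
  simp only [LieAlgebroid.generatedBracket, mul_assoc, gen_ι_mul, lieDer_mul, pow_succ, sub_mul,
    smul_mul_assoc]
  rcases neg_one_pow_eq_or (ExteriorAlgebra R M) p with h | h <;> rw [h] <;>
    simp only [mul_sub, one_mul, mul_neg, neg_mul, mul_add] <;> abel

theorem generatedBracket_mul (p q : ℕ) {a b : ExteriorAlgebra R M} (e : ExteriorAlgebra R M)
    (ha : a ∈ ⋀[R]^p M) (hb : b ∈ ⋀[R]^q M) :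
    LieAlgebroid.generatedBracket δ.gen p a (b * e) = LieAlgebroid.generatedBracket δ.gen p a b * e +
      (-1) ^ ((p + 1) * q) * (b * LieAlgebroid.generatedBracket δ.gen p a e) := by
  refine extPow_induction (P := fun p a =>
    LieAlgebroid.generatedBracket δ.gen p a (b * e) = LieAlgebroid.generatedBracket δ.gen p a b * e +
      (-1) ^ ((p + 1) * q) * (b * LieAlgebroid.generatedBracket δ.gen p a e)) (fun r => ?_)
    (fun k x y hx hy => ?_) (fun k m x hx h => ?_) p ha
  · simp only [generatedBracket_algebraMap, zero_add, one_mul]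
    rw [L.contract_mul_of_mem r q e hb]
    rw [neg_add, neg_mul, mul_neg, mul_neg]
  · have hadd : ∀ z, LieAlgebroid.generatedBracket δ.gen k (x + y) z =
        LieAlgebroid.generatedBracket δ.gen k x z + LieAlgebroid.generatedBracket δ.gen k y z :=
          fun z => by
      simp only [LieAlgebroid.generatedBracket, add_mul, map_add, mul_add, mul_sub]
      abel
    rw [hadd, hadd, hadd, hx, hy]
    simp only [add_mul, mul_add]
    abel
  · have h₁ := mul_ι_of_mem m q hb
    have h₂ := mul_comm_of_mem k q hx hb
    rw [generatedBracket_ι_mul, generatedBracket_ι_mul, generatedBracket_ι_mul, h, lieDer_mul]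
    -- `e₁` and `e₂` bring all products to a common order of factors; what remains is a check of
    -- signs over the parities of `k * q`, `q` and `k`.
    have e₁ : ∀ z, b * (ExteriorAlgebra.ι R m * z) = (-1) ^ q * (ExteriorAlgebra.ι R m * (b * z)) :=
      fun z => by rw [← mul_assoc, h₁]; simp only [mul_assoc]
    have e₂ : ∀ z, x * (b * z) = (-1) ^ (k * q) * (b * (x * z)) :=
      fun z => by rw [← mul_assoc, h₂]; simp only [mul_assoc]
    simp only [mul_add, e₁, e₂, add_mul, mul_assoc, one_mul, pow_add]
    rcases neg_one_pow_eq_or (ExteriorAlgebra R M) (k * q) with h | h <;>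
      rcases neg_one_pow_eq_or (ExteriorAlgebra R M) q with h' | h' <;>
      rcases neg_one_pow_eq_or (ExteriorAlgebra R M) k with h'' | h'' <;> rw [h, h', h''] <;>
      simp only [one_mul, neg_mul, mul_neg, neg_neg] <;> abel

end Divergence

end LieRinehartData

end LieRinehart

/-! ### Naturality of these operators under semilinear maps. -/

section Naturality

variable {K : Type u} [Field K] {R S : Type u} [CommRing R] [Algebra K R] [CommRing S]
  [Algebra K S] {M N : Type u} [AddCommGroup M] [Module K M] [Module R M] [IsScalarTower K R M]
  [AddCommGroup N] [Module K N] [Module S N] [IsScalarTower K S N]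
  (L : LieRinehartData K R M) (L' : LieRinehartData K S N)

namespace LieRinehartData

theorem extMap_smul (σ : R →ₐ[K] S) (l : M →ₗ[K] N) (hl) (f : R) (a : ExteriorAlgebra R M) :
    extMap σ l hl (f • a) = σ f • extMap σ l hl a := by
  rw [Algebra.smul_def, map_mul, extMap_algebraMap, Algebra.smul_def]

variable (σ : R →ₐ[K] S) (l : M →ₗ[K] N) (hl : ∀ (r : R) (m : M), l (r • m) = σ r • l m)
  (ha : ∀ m f, σ (L.anchor m f) = L'.anchor (l m) (σ f))
  (hb : ∀ m m', l (L.bracket m m') = L'.bracket (l m) (l m'))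

include ha hb in
theorem extMap_lieDer (D : M) (a : ExteriorAlgebra R M) :
    extMap σ l hl (L.lieDer D a) = L'.lieDer (l D) (extMap σ l hl a) := by
  induction a using ext_induction with
  | algebraMap r =>
    rw [lieDer_algebraMap, extMap_algebraMap, extMap_algebraMap, lieDer_algebraMap, ha]
  | add x y hx hy => simp only [map_add, hx, hy]
  | ι_mul m x hx =>
    rw [lieDer_ι_mul, map_add, map_mul, map_mul, map_mul, extMap_ι, extMap_ι, lieDer_ι_mul, hx, hb]

include ha in
theorem extMap_contract (f : R) (a : ExteriorAlgebra R M) :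
    extMap σ l hl (L.contract f a) = L'.contract (σ f) (extMap σ l hl a) := by
  induction a using ext_induction with
  | algebraMap r => rw [extMap_algebraMap, contract_algebraMap, contract_algebraMap, map_zero]
  | add x y hx hy => simp only [map_add, hx, hy]
  | ι_mul m x hx =>
    rw [contract_ι_mul, map_sub, map_mul, map_mul, extMap_ι, contract_ι_mul, hx, extMap_smul, ha]

-- Used twice: with `σ` and `l` restriction maps, so that `Δ` is a morphism of presheaves, and with
-- `σ` the identity and `l` a component of `φ`, so that `⋀ φ` commutes with the operators.
include ha hb in
theorem extMap_gen (δ : L.Divergence) (δ' : L'.Divergence)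
    (hδ : ∀ m, σ (δ.toFun m) = δ'.toFun (l m)) (a : ExteriorAlgebra R M) :
    extMap σ l hl (δ.gen a) = δ'.gen (extMap σ l hl a) := by
  induction a using ext_induction with
  | algebraMap r =>
    rw [extMap_algebraMap, Divergence.gen_algebraMap, Divergence.gen_algebraMap, map_zero]
  | add x y hx hy => simp only [map_add, hx, hy]
  | ι_mul m x hx =>
    rw [Divergence.gen_ι_mul, map_sub, map_sub, map_mul, map_mul, extMap_ι, Divergence.gen_ι_mul,
      hx, extMap_smul, extMap_lieDer L L' σ l hl ha hb, hδ]

end LieRinehartData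

end Naturality

/-! ### The top exterior power of a free module. -/

section TopDegree

variable {R M : Type*} [CommRing R] [AddCommGroup M] [Module R M] {n : ℕ}

/-- An alternating map is determined by its values on injective families of basis vectors. As there
are exactly `n` of these vectors, such a family is a permutation of the basis, and both sides change
by its sign. -/
theorem alternatingMap_eq_det_smul {N : Type*} [AddCommGroup N] [Module R N]
    (b : Module.Basis (Fin n) R M) (f : M [⋀^Fin n]→ₗ[R] N) (v : Fin n → M) :
    f v = b.det v • f b := by
  let g : M [⋀^Fin n]→ₗ[R] N := (LinearMap.toSpanSingleton R N (f b)).compAlternatingMap b.det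
  suffices h : f = g from congrArg (fun F => F v) h
  refine Module.Basis.ext_alternating b fun w hw => ?_
  let σ : Equiv.Perm (Fin n) := Equiv.ofBijective w (Finite.injective_iff_bijective.1 hw)
  have hv : (fun i => b (w i)) = b ∘ σ := rfl
  rw [hv, AlternatingMap.map_perm, AlternatingMap.map_perm]
  congr 1
  change f b = b.det b • f b
  rw [Module.Basis.det_self, one_smul]

/-- The generator of the top exterior power of a free module defined by a basis. -/
def volumeElement (b : Module.Basis (Fin n) R M) : ExteriorAlgebra R M :=
  ExteriorAlgebra.ιMulti R n b

theorem volumeElement_mem (b : Module.Basis (Fin n) R M) : volumeElement b ∈ ⋀[R]^n M :=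
  ExteriorAlgebra.ιMulti_range R n ⟨_, rfl⟩

theorem exists_eq_smul_volumeElement (b : Module.Basis (Fin n) R M) {a : ExteriorAlgebra R M}
    (ha : a ∈ ⋀[R]^n M) : ∃ f : R, a = f • volumeElement b := by
  rw [← ExteriorAlgebra.ιMulti_span_fixedDegree] at ha
  have h : Submodule.span R (Set.range (ExteriorAlgebra.ιMulti R n)) ≤
      Submodule.span R {volumeElement b} := by
    rw [Submodule.span_le]
    rintro _ ⟨v, rfl⟩
    rw [alternatingMap_eq_det_smul b]
    exact Submodule.smul_mem _ _ (Submodule.mem_span_singleton_self _)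
  obtain ⟨f, hf⟩ := Submodule.mem_span_singleton.1 (h ha)
  exact ⟨f, hf.symm⟩

/-- The functional reads off coefficients in top degree: it shows that the volume element has no
annihilator and, on the target of a linear map, produces the determinant of that map. -/
theorem exists_functional_volumeElement (b : Module.Basis (Fin n) R M) :
    ∃ F : ExteriorAlgebra R M →ₗ[R] R, ∀ v, F (ExteriorAlgebra.ιMulti R n v) = b.det v := by
  refine ⟨ExteriorAlgebra.liftAlternating (fun k => if h : k = n then h ▸ b.det else 0),
    fun v => ?_⟩
  rw [ExteriorAlgebra.liftAlternating_apply_ιMulti]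
  simp

theorem smul_volumeElement_eq_zero (b : Module.Basis (Fin n) R M) {f : R}
    (h : f • volumeElement b = 0) : f = 0 := by
  obtain ⟨F, hF⟩ := exists_functional_volumeElement b
  have := congrArg F h
  rwa [map_smul, volumeElement, hF, Module.Basis.det_self, smul_eq_mul, mul_one, map_zero] at this

theorem ι_mul_eq_zero_of_mem (b : Module.Basis (Fin n) R M) (m : M) {a : ExteriorAlgebra R M}
    (ha : a ∈ ⋀[R]^n M) : ExteriorAlgebra.ι R m * a = 0 := by
  obtain ⟨f, rfl⟩ := exists_eq_smul_volumeElement b ha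
  rw [mul_smul_comm, ← b.sum_repr m, map_sum, Finset.sum_mul, Finset.sum_eq_zero, smul_zero]
  intro i _
  rw [map_smul, smul_mul_assoc, volumeElement, ExteriorAlgebra.ιMulti_apply,
    ExteriorAlgebra.ι_mul_prod_list, smul_zero]

end TopDegree

/-! ### The determinant of an injective matrix is not a zero divisor. -/

section Determinant

open Matrix

/-- If `g ≠ 0`, some multiple `rg` has a prime annihilator `P`. Then `det A` lies in `P`, so `A` has
a kernel vector over the domain `R/P`; multiplying a lift of it by `rg` gives a vector in the kernel
of `A` itself. -/
theorem det_mul_eq_zero_of_isNoetherianRing {R : Type*} [CommRing R] [IsNoetherianRing R] {n : ℕ}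
    (A : Matrix (Fin n) (Fin n) R) (hA : Function.Injective A.mulVec) {g : R} (hg : g * A.det = 0) :
    g = 0 := by
  by_contra hg0
  let J : Ideal R := Ideal.span {g}
  have hne : (⟨g, Ideal.mem_span_singleton_self g⟩ : J) ≠ 0 := fun h =>
    hg0 (congrArg Subtype.val h)
  obtain ⟨P, hP, -⟩ := exists_le_isAssociatedPrime_of_isNoetherianRing R _ hne
  obtain ⟨hprime, ⟨x, hxJ⟩, hx⟩ := Submodule.isAssociatedPrime_iff.1 hP
  obtain ⟨r, rfl⟩ := Ideal.mem_span_singleton'.1 hxJ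
  have hmem : ∀ y : R, y ∈ P ↔ y * (r * g) = 0 := by
    intro y
    rw [hx, Submodule.mem_colon_singleton, Submodule.mem_bot, Subtype.ext_iff]
    rfl
  have hdet : (A.map (Ideal.Quotient.mk P)).det = 0 := by
    rw [← RingHom.mapMatrix_apply, ← RingHom.map_det, Ideal.Quotient.eq_zero_iff_mem, hmem]
    linear_combination r * hg
  obtain ⟨w, hw0, hw⟩ := Matrix.exists_mulVec_eq_zero_iff.2 hdet
  choose v hv using fun i => Ideal.Quotient.mk_surjective (w i)
  refine hw0 (funext fun i => ?_)
  have hAv : ∀ i, A.mulVec v i ∈ P := fun i => by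
    rw [← Ideal.Quotient.eq_zero_iff_mem, RingHom.map_mulVec]
    have : (Ideal.Quotient.mk P) ∘ v = w := funext hv
    rw [this, hw]
    rfl
  -- The entries of `A v` lie in `P`, hence are killed by `r * g`. Injectivity of `A` then puts the
  -- entries of `v` in `P`, contradicting `w ≠ 0`.
  have h0 : (r * g) • v = 0 := hA (by
    rw [Matrix.mulVec_smul, Matrix.mulVec_zero]
    funext i
    have := (hmem _).1 (hAv i)
    simpa [mul_comm] using this)
  rw [← hv i, Pi.zero_apply, Ideal.Quotient.eq_zero_iff_mem, hmem, mul_comm]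
  exact congrFun h0 i

/-- Only finitely many elements are involved, so the statement descends to the subring generated by
`g` and the entries of `A`. It is Noetherian by Hilbert's basis theorem, and injectivity passes to
it. -/
theorem det_mul_eq_zero_of_injective {R : Type*} [CommRing R] {n : ℕ}
    (A : Matrix (Fin n) (Fin n) R) (hA : Function.Injective A.mulVec) {g : R} (hg : g * A.det = 0) :
    g = 0 := by
  let s : Set R := insert g (Set.range fun p : Fin n × Fin n => A p.1 p.2)
  have hs : s.Finite := (Set.finite_range _).insert g
  let T : Subalgebra ℤ R := Algebra.adjoin ℤ s
  have : IsNoetherianRing T := by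
    have : Algebra.FiniteType ℤ T := (Subalgebra.fg_iff_finiteType T).1 ⟨hs.toFinset, by simp [T]⟩
    exact Algebra.FiniteType.isNoetherianRing ℤ T
  let B : Matrix (Fin n) (Fin n) T := fun i j =>
    ⟨A i j, Algebra.subset_adjoin (Set.mem_insert_of_mem _ ⟨(i, j), rfl⟩)⟩
  have hBA : T.val.toRingHom.mapMatrix B = A := rfl
  have hB : Function.Injective B.mulVec := fun v w h => by
    have h' := hA (a₁ := T.val ∘ v) (a₂ := T.val ∘ w) (funext fun i => by
      have := congrArg T.val (congrFun h i)
      have e : ∀ v, T.val (B.mulVec v i) = A.mulVec (T.val ∘ v) i := fun v =>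
        RingHom.map_mulVec T.val.toRingHom B v i
      rwa [e, e] at this)
    exact funext fun i => Subtype.ext (congrFun h' i)
  let g' : T := ⟨g, Algebra.subset_adjoin (Set.mem_insert _ _)⟩
  have hg' : g' * B.det = 0 := Subtype.ext (by
    have e : ((B.det : T) : R) = A.det := by
      rw [← hBA, ← RingHom.map_det]
      rfl
    change g * ((B.det : T) : R) = 0
    rw [e, hg])
  exact congrArg Subtype.val (det_mul_eq_zero_of_isNoetherianRing B hB hg')

/-- The image of the volume element is `det φ` times the volume element of the target. This is the
algebraic core of the injectivity of `⋀^n φ`. -/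
theorem smul_map_volumeElement_eq_zero {R M N : Type*} [CommRing R] [AddCommGroup M] [Module R M]
    [AddCommGroup N] [Module R N] {n : ℕ} (b : Module.Basis (Fin n) R M)
    (b' : Module.Basis (Fin n) R N) (φ : M →ₗ[R] N) (hφ : Function.Injective φ) {g : R}
    (hg : g • ExteriorAlgebra.map φ (volumeElement b) = 0) : g = 0 := by
  obtain ⟨F, hF⟩ := exists_functional_volumeElement b'
  rw [volumeElement, ExteriorAlgebra.map_apply_ιMulti] at hg
  have h := congrArg F hg
  rw [map_smul, hF, map_zero, smul_eq_mul, Module.Basis.det_apply] at h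
  refine det_mul_eq_zero_of_injective _ ?_ h
  have he : b'.toMatrix (φ ∘ b) = LinearMap.toMatrix b b' φ := by
    ext i j
    simp [Module.Basis.toMatrix_apply, LinearMap.toMatrix_apply]
  rw [he]
  intro v w hvw
  have : ∀ v, (LinearMap.toMatrix b b' φ).mulVec v = b'.repr (φ (b.equivFun.symm v)) := fun v => by
    rw [← LinearMap.toMatrix_mulVec_repr b b']
    exact congrArg _ (b.equivFun.apply_symm_apply v).symm
  simp only [this] at hvw
  exact b.equivFun.symm.injective (hφ (b'.repr.injective (DFunLike.coe_injective hvw)))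

end Determinant

/-! ### Gluing, and local description of sections of the sheafified exterior algebra. -/

section Local

variable {K : Type u} [Field K] {X : TopCat.{u}} {O : Sh X (CommAlgCat.{u} K)}

theorem resO_self {U : Opens X} (f : secO O U) : resO O (le_refl U) f = f := by
  change (O.obj.map (𝟙 (op U))).hom f = f
  rw [CategoryTheory.Functor.map_id]
  rfl

theorem resO_resO {U V W : Opens X} (h : V ≤ U) (h' : W ≤ V) (f : secO O U) :
    resO O h' (resO O h f) = resO O (h'.trans h) f := by
  change (O.obj.map (homOfLE h).op ≫ O.obj.map (homOfLE h').op).hom f = _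
  rw [← Functor.map_comp]
  rfl

/-- Sections of a commutative `K`-algebra are morphisms from the polynomial ring. -/
def forgetCorepresentableBy :
    (forget (CommAlgCat.{u} K)).CorepresentableBy (CommAlgCat.of K (Polynomial K)) where
  homEquiv {A} :=
    { toFun := fun F => F.hom Polynomial.X
      invFun := fun a => CommAlgCat.ofHom (Polynomial.aeval a)
      left_inv := fun F => by
        ext
        simp
      right_inv := fun a => Polynomial.aeval_X a }
  homEquiv_comp _ _ := rfl

/-- Corepresentable functors preserve limits; this is the input for the unique gluing of sections of
`O`. -/
instance : (forget (CommAlgCat.{u} K)).IsCorepresentable :=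
  forgetCorepresentableBy.isCorepresentable

/-- Gluing of sections of the structure sheaf given locally and determined by a local property. -/
theorem exists_secO_of_local {U : Opens X} (P : ∀ V : Opens X, V ≤ U → secO O V → Prop)
    (P_res : ∀ {V W : Opens X} (hV : V ≤ U) (h : W ≤ V) (f : secO O V), P V hV f →
      P W (h.trans hV) (resO O h f))
    (P_unique : ∀ {V : Opens X} (hV : V ≤ U) (f g : secO O V), P V hV f → P V hV g → f = g)
    (P_exists : ∀ x ∈ U, ∃ (V : Opens X) (h : V ≤ U), x ∈ V ∧ ∃ f, P V h f) :
    ∃ f : secO O U, ∀ x ∈ U, ∃ (V : Opens X) (h : V ≤ U), x ∈ V ∧ P V h (resO O h f) := by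
  choose V hV hxV f hf using fun x : U => P_exists x.1 x.2
  obtain ⟨s, hs, -⟩ := TopCat.Sheaf.existsUnique_gluing' (F := O) V U (fun x => homOfLE (hV x))
    (fun x hx => Opens.mem_iSup.2 ⟨⟨x, hx⟩, hxV _⟩) f (fun x y => by
      exact P_unique (inf_le_left.trans (hV x)) _ _ (P_res (hV x) inf_le_left _ (hf x))
        (P_res (hV y) inf_le_right _ (hf y)))
  refine ⟨s, fun x hx => ⟨V ⟨x, hx⟩, hV _, hxV _, ?_⟩⟩
  have : resO O (hV ⟨x, hx⟩) s = f ⟨x, hx⟩ := hs ⟨x, hx⟩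
  rw [this]
  exact hf _

theorem secO_eq_of_local {U : Opens X} (f g : secO O U) (h : ∀ x ∈ U, ∃ (V : Opens X) (h : V ≤ U),
    x ∈ V ∧ resO O h f = resO O h g) : f = g := by
  choose V hV hxV e using fun x : U => h x.1 x.2
  exact TopCat.Sheaf.eq_of_locally_eq' (F := O) V U (fun x => homOfLE (hV x))
    (fun x hx => Opens.mem_iSup.2 ⟨⟨x, hx⟩, hxV _⟩) f g e

namespace ModuleSheaf

theorem eq_of_local (E : ModuleSheaf O) {U : Opens X} (s t : E.sec U)
    (h : ∀ x ∈ U, ∃ (V : Opens X) (h : V ≤ U), x ∈ V ∧ E.res h s = E.res h t) : s = t := by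
  choose V hV hxV e using fun x : U => h x.1 x.2
  exact TopCat.Sheaf.eq_of_locally_eq' (F := E.toSheaf) V U (fun x => homOfLE (hV x))
    (fun x hx => Opens.mem_iSup.2 ⟨⟨x, hx⟩, hxV _⟩) s t e

variable (E : ModuleSheaf O)

theorem ext_eq_of_local {U : Opens X} (s t : E.Ext U)
    (h : ∀ x ∈ U, ∃ (V : Opens X) (h : V ≤ U), x ∈ V ∧ E.extRes h s = E.extRes h t) : s = t :=
  E.extModule.eq_of_local s t h

theorem extRes_self {U : Opens X} (s : E.Ext U) : E.extRes (le_refl U) s = s :=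
  E.extModule.res_self s

theorem extRes_extRes {U V W : Opens X} (h : V ≤ U) (h' : W ≤ V) (s : E.Ext U) :
    E.extRes h' (E.extRes h s) = E.extRes (h'.trans h) s :=
  E.extModule.res_res h h' s

/-- Restriction of sections of the presheaf of exterior algebras. -/
def preRes {U V : Opens X} (h : V ≤ U) :
    ExteriorAlgebra (secO O U) (E.sec U) →ₐ[K] ExteriorAlgebra (secO O V) (E.sec V) :=
  extMap (resO O h) (E.res h) (E.res_smul h)

theorem preRes_ι {U V : Opens X} (h : V ≤ U) (m : E.sec U) :
    E.preRes h (ExteriorAlgebra.ι _ m) = ExteriorAlgebra.ι _ (E.res h m) :=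
  extMap_ι _ _ _ _

theorem preRes_smul {U V : Opens X} (h : V ≤ U) (f : secO O U)
    (a : ExteriorAlgebra (secO O U) (E.sec U)) :
    E.preRes h (f • a) = resO O h f • E.preRes h a := by
  rw [preRes, Algebra.smul_def, map_mul, extMap_algebraMap, Algebra.smul_def]

theorem preRes_mem {U V : Opens X} (h : V ≤ U) (k : ℕ)
    {a : ExteriorAlgebra (secO O U) (E.sec U)} (ha : a ∈ ⋀[secO O U]^k (E.sec U)) :
    E.preRes h a ∈ ⋀[secO O V]^k (E.sec V) :=
  extMap_mem _ _ _ k ha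

theorem extRes_toExt' {U V : Opens X} (h : V ≤ U)
    (a : ExteriorAlgebra (secO O U) (E.sec U)) :
    E.extRes h (E.toExt U a) = E.toExt V (E.preRes h a) :=
  E.extRes_toExt h a

theorem toExt_smul (U : Opens X) (f : secO O U) (a : ExteriorAlgebra (secO O U) (E.sec U)) :
    E.toExt U (f • a) = E.ofO U f * E.toExt U a :=
  (E.ofO_comm U f a).symm

theorem toExt_algebraMap (U : Opens X) (f : secO O U) :
    E.toExt U (algebraMap _ _ f) = E.ofO U f := rfl

theorem toExt_ι (U : Opens X) (m : E.sec U) :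
    E.toExt U (ExteriorAlgebra.ι _ m) = E.ofE U m := rfl

theorem extRes_ofE {U V : Opens X} (h : V ≤ U) (m : E.sec U) :
    E.extRes h (E.ofE U m) = E.ofE V (E.res h m) := by
  rw [ofE, extRes_toExt', preRes_ι]
  rfl

theorem exists_toExt {U : Opens X} (s : E.Ext U) {x : X} (hx : x ∈ U) :
    ∃ (V : Opens X) (h : V ≤ U), x ∈ V ∧ ∃ a, E.extRes h s = E.toExt V a := by
  have h := Presheaf.imageSieve_mem (Opens.grothendieckTopology X)
    (toSheafify (Opens.grothendieckTopology X) E.extPresheaf) (U := op U) s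
  obtain ⟨V, f, ⟨a, ha⟩, hxV⟩ := h x hx
  exact ⟨V, f.le, hxV, a, ha.symm⟩

theorem preRes_eq_of_toExt_eq {U : Opens X} {a b : ExteriorAlgebra (secO O U) (E.sec U)}
    (hab : E.toExt U a = E.toExt U b) {x : X} (hx : x ∈ U) :
    ∃ (V : Opens X) (h : V ≤ U), x ∈ V ∧ E.preRes h a = E.preRes h b := by
  have h := Presheaf.equalizerSieve_mem (Opens.grothendieckTopology X)
    (toSheafify (Opens.grothendieckTopology X) E.extPresheaf) (X := op U) a b hab
  obtain ⟨V, f, hf, hxV⟩ := h x hx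
  exact ⟨V, f.le, hxV, hf⟩

/-- The canonical map to `⋀ E`, as a morphism of presheaves of vector spaces. -/
def toExtHom :
    E.extPresheaf ⋙ forget₂ (AlgCat.{u} K) (ModuleCat.{u} K) ⟶ E.extModule.toFunctor where
  app U := ModuleCat.ofHom (E.toExt U.unop).toLinearMap
  naturality U V i := by
    ext a
    exact (E.extRes_toExt i.unop.le a).symm

instance : Presheaf.IsLocallySurjective (Opens.grothendieckTopology X) E.toExtHom where
  imageSieve_mem {U} s x hx := by
    obtain ⟨V, h, hxV, a, ha⟩ := E.exists_toExt (U := U) s hx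
    exact ⟨V, homOfLE h, ⟨a, ha.symm⟩, hxV⟩

instance : Presheaf.IsLocallyInjective (Opens.grothendieckTopology X) E.toExtHom where
  equalizerSieve_mem {U} a b hab x hx := by
    obtain ⟨V, h, hxV, e⟩ := E.preRes_eq_of_toExt_eq (U := U.unop) (a := a) (b := b) hab hx
    exact ⟨V, homOfLE h, e, hxV⟩

/-- An operator on the presheaf of exterior algebras extends to `⋀ E`. -/
theorem exists_extend (T : ∀ U : Opens X, Module.End K (ExteriorAlgebra (secO O U) (E.sec U)))
    (hT : ∀ {U V : Opens X} (h : V ≤ U) a, E.preRes h (T U a) = T V (E.preRes h a)) :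
    ∃ T' : ∀ U : Opens X, Module.End K (E.Ext U),
      (∀ {U V : Opens X} (h : V ≤ U) (s : E.Ext U), T' V (E.extRes h s) = E.extRes h (T' U s)) ∧
      ∀ (U : Opens X) a, T' U (E.toExt U a) = E.toExt U (T U a) := by
  let τ : E.extPresheaf ⋙ forget₂ (AlgCat.{u} K) (ModuleCat.{u} K) ⟶
      E.extPresheaf ⋙ forget₂ (AlgCat.{u} K) (ModuleCat.{u} K) :=
    { app := fun U => ModuleCat.ofHom (T U.unop)
      naturality := fun U V i => by
        ext a
        exact (hT i.unop.le a).symm }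
  -- The operators are only `K`-linear, so the universal property of sheafification for algebras
  -- does not apply. Instead the canonical map is viewed in vector spaces, where being locally
  -- bijective suffices for maps into a sheaf to extend uniquely.
  have hW := GrothendieckTopology.W_of_isLocallyBijective
    (J := Opens.grothendieckTopology X) E.toExtHom
  obtain ⟨g, hg⟩ := (hW _ E.extModule.isSheaf).2 (τ ≫ E.toExtHom)
  refine ⟨fun U => (g.app (op U)).hom, fun {U V} h s => ?_, fun U a => ?_⟩
  · exact ConcreteCategory.congr_hom (g.naturality (homOfLE h).op) s
  · exact ConcreteCategory.congr_hom (NatTrans.congr_app hg (op U)) a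

theorem hasDegree_toExt {U : Opens X} (k : ℕ) {a : ExteriorAlgebra (secO O U) (E.sec U)}
    (ha : a ∈ ⋀[secO O U]^k (E.sec U)) : E.HasDegree k (E.toExt U a) :=
  fun _ hx => ⟨U, le_rfl, hx, a, ha, E.extRes_self _⟩

theorem hasDegree_extRes {U V : Opens X} (h : V ≤ U) (k : ℕ) {s : E.Ext U} (hs : E.HasDegree k s) :
    E.HasDegree k (E.extRes h s) :=
  (E.extSub k).res_mem h hs

theorem hasDegree_of_local {U : Opens X} (k : ℕ) (s : E.Ext U)
    (h : ∀ x ∈ U, ∃ (V : Opens X) (h : V ≤ U), x ∈ V ∧ E.HasDegree k (E.extRes h s)) :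
    E.HasDegree k s :=
  (E.extSub k).local_mem s h

theorem exists_basis {n : ℕ} (hE : E.IsLocallyFree n) (x : X) : ∃ U : Opens X, x ∈ U ∧
    ∃ b : ∀ V ≤ U, Module.Basis (Fin n) (secO O V) (E.sec V),
      ∀ (V W : Opens X) (hV : V ≤ U) (h : W ≤ V),
        E.preRes h (volumeElement (b V hV)) = volumeElement (b W (h.trans hV)) := by
  obtain ⟨U, hxU, e, he⟩ := hE x
  refine ⟨U, hxU, fun V hV => Module.Basis.mk (he V hV).1 (he V hV).2.ge, fun V W hV h => ?_⟩
  rw [volumeElement, volumeElement, ExteriorAlgebra.ιMulti_apply, ExteriorAlgebra.ιMulti_apply,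
    map_list_prod, List.map_ofFn]
  congr 2
  funext i
  simp [preRes_ι, E.res_res]

/-- Functions act faithfully on `⋀^n E`, since locally the volume element has zero annihilator. All
uniqueness statements about divergences come from here. -/
theorem ofO_injective_of_smul {n : ℕ} (hE : E.IsLocallyFree n) {U : Opens X} {f g : secO O U}
    (h : ∀ (V : Opens X) (hV : V ≤ U) (a : ExteriorAlgebra (secO O V) (E.sec V)),
      a ∈ ⋀[secO O V]^n (E.sec V) →
        E.ofO V (resO O hV f) * E.toExt V a = E.ofO V (resO O hV g) * E.toExt V a) : f = g := by
  refine secO_eq_of_local f g fun x hx => ?_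
  obtain ⟨W, hxW, b, hb⟩ := E.exists_basis hE x
  have h₁ := h (U ⊓ W) inf_le_left _ (volumeElement_mem (b _ inf_le_right))
  rw [ofO_comm, ofO_comm] at h₁
  obtain ⟨V, hV, hxV, e⟩ := E.preRes_eq_of_toExt_eq h₁ (x := x) ⟨hx, hxW⟩
  refine ⟨V, hV.trans inf_le_left, hxV, ?_⟩
  rw [preRes_smul, preRes_smul, hb, resO_resO, resO_resO, ← sub_eq_zero, ← sub_smul] at e
  exact sub_eq_zero.1 (smul_volumeElement_eq_zero _ e)

theorem ofE_mul_eq_zero {n : ℕ} (hE : E.IsLocallyFree n) {U : Opens X} (D : E.sec U) {s : E.Ext U}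
    (hs : E.HasDegree n s) : E.ofE U D * s = 0 := by
  refine E.ext_eq_of_local _ _ fun x hx => ?_
  obtain ⟨W, hxW, b, -⟩ := E.exists_basis hE x
  obtain ⟨V, hV, hxV, a, ha, e⟩ := hs x hx
  refine ⟨V ⊓ W, inf_le_left.trans hV, ⟨hxV, hxW⟩, ?_⟩
  rw [map_mul, map_zero, ← E.extRes_extRes hV inf_le_left s, e, extRes_toExt', extRes_ofE,
    ← toExt_ι, ← map_mul, ι_mul_eq_zero_of_mem (b _ inf_le_right) _ (E.preRes_mem _ n ha), map_zero]

end ModuleSheaf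

end Local

/-! ### Homogeneous sections and their common local representatives. -/

namespace ModuleSheaf

variable {K : Type u} [Field K] {X : TopCat.{u}} {O : Sh X (CommAlgCat.{u} K)} (E : ModuleSheaf O)

theorem exists_toExt_triple {U : Opens X} (p q : ℕ) {a b : E.Ext U} (e : E.Ext U)
    (ha : E.HasDegree p a) (hb : E.HasDegree q b) {x : X} (hx : x ∈ U) :
    ∃ (V : Opens X) (h : V ≤ U), x ∈ V ∧ ∃ a' ∈ ⋀[secO O V]^p (E.sec V),
      ∃ b' ∈ ⋀[secO O V]^q (E.sec V), ∃ e', E.extRes h a = E.toExt V a' ∧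
        E.extRes h b = E.toExt V b' ∧ E.extRes h e = E.toExt V e' := by
  obtain ⟨V₁, h₁, hx₁, a', ha', ea⟩ := ha x hx
  obtain ⟨V₂, h₂, hx₂, b', hb', eb⟩ := E.hasDegree_extRes h₁ q hb x hx₁
  obtain ⟨V, h₃, hx₃, e', ee⟩ := E.exists_toExt (E.extRes (h₂.trans h₁) e) hx₂
  refine ⟨V, h₃.trans (h₂.trans h₁), hx₃, E.preRes (h₃.trans h₂) a', E.preRes_mem _ p ha',
    E.preRes h₃ b', E.preRes_mem _ q hb', e', ?_, ?_, ?_⟩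
  · rw [← extRes_toExt', ← ea, extRes_extRes]
  · rw [← extRes_toExt', ← eb, extRes_extRes, extRes_extRes]
  · rw [← ee, extRes_extRes]

theorem hasDegree_ofE {U : Opens X} (D : E.sec U) : E.HasDegree 1 (E.ofE U D) := by
  refine E.hasDegree_toExt 1 ?_
  have h := ι_mul_mem D 0 (algebraMap_mem_extPow (1 : secO O U))
  rwa [map_one, mul_one] at h

theorem hasDegree_ofO {U : Opens X} (f : secO O U) : E.HasDegree 0 (E.ofO U f) :=
  E.hasDegree_toExt 0 (algebraMap_mem_extPow f)

theorem hasDegree_ofE_mul {U : Opens X} (D : E.sec U) {k : ℕ} {s : E.Ext U}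
    (hs : E.HasDegree k s) : E.HasDegree (k + 1) (E.ofE U D * s) := by
  refine E.hasDegree_of_local _ _ fun x hx => ?_
  obtain ⟨V, h, hxV, a, ha, e⟩ := hs x hx
  refine ⟨V, h, hxV, ?_⟩
  rw [map_mul, e, extRes_ofE, ← toExt_ι, ← map_mul]
  exact E.hasDegree_toExt _ (ι_mul_mem _ k ha)

theorem ofE_add {U : Opens X} (D D' : E.sec U) : E.ofE U (D + D') = E.ofE U D + E.ofE U D' := by
  rw [ofE, map_add, map_add]
  rfl

theorem ofE_smul {U : Opens X} (f : secO O U) (D : E.sec U) :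
    E.ofE U (f • D) = E.ofO U f * E.ofE U D := by
  rw [ofE, map_smul, toExt_smul]
  rfl

theorem extIncl_smul (k : ℕ) {U : Opens X} (f : secO O U) (s : (E.extPow k).sec U) :
    E.extIncl k U (f • s) = E.ofO U f * E.extIncl k U s := rfl

end ModuleSheaf

/-! ### From a flat divergence on a Lie algebroid to a flat connection and a generating operator. -/

namespace LieAlgebroid

variable {K : Type u} [Field K] {X : TopCat.{u}} {O : Sh X (CommAlgCat.{u} K)}

theorem map_generatedBracket {A B F : Type u} [Ring A] [Ring B] [FunLike F A B] [RingHomClass F A B]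
    (f : F) (Δ : A → A) (Δ' : B → B) (h : ∀ a, f (Δ a) = Δ' (f a)) (p : ℕ) (a b : A) :
    f (generatedBracket Δ p a b) = generatedBracket Δ' p (f a) (f b) := by
  simp only [generatedBracket, map_mul, map_sub, map_pow, map_neg, map_one, h]

/-- The Lie-Rinehart structure on the sections over an open set. -/
def lieRinehart (L : LieAlgebroid O) (U : Opens X) : LieRinehartData K (secO O U) (L.sec U) where
  bracket := L.bracket U
  bracket_self := L.bracket_self
  jacobi := L.jacobi
  anchor := L.anchor U
  anchor_bracket := L.anchor_bracket
  bracket_smul := L.bracket_smul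

variable {L' L : LieAlgebroid O}

theorem preRes_lieDer {U V : Opens X} (h : V ≤ U) (D : L.sec U)
    (a : ExteriorAlgebra (secO O U) (L.sec U)) : L.preRes h ((L.lieRinehart U).lieDer D a) =
      (L.lieRinehart V).lieDer (L.res h D) (L.preRes h a) :=
  LieRinehartData.extMap_lieDer _ _ _ _ (L.res_smul h) (fun m f => L.res_anchor h m f)
    (fun m m' => L.res_bracket h m m') D a

/-- A flat divergence on a Lie algebroid. -/
structure FlatDivergence (L : LieAlgebroid O) where
  toFun : ∀ U : Opens X, L.sec U →ₗ[K] secO O U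
  res_toFun : ∀ {U V : Opens X} (h : V ≤ U) (D : L.sec U),
    resO O h (toFun U D) = toFun V (L.res h D)
  map_smul : ∀ {U : Opens X} (f : secO O U) (D : L.sec U),
    toFun U (f • D) = f * toFun U D - L.anchor U D f
  map_bracket : ∀ {U : Opens X} (D D' : L.sec U),
    toFun U (L.bracket U D D') = L.anchor U D (toFun U D') - L.anchor U D' (toFun U D)

namespace FlatDivergence

/-- The divergence over an open set. -/
def onSections (δ : FlatDivergence L) (U : Opens X) : (L.lieRinehart U).Divergence where
  toFun := δ.toFun U
  map_smul := δ.map_smul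
  map_bracket := δ.map_bracket

/-- The pullback of a divergence along a morphism of Lie algebroids. -/
def comap (δ : FlatDivergence L) (φ : Hom L' L) : FlatDivergence L' where
  toFun U := δ.toFun U ∘ₗ (φ.app U).restrictScalars K
  res_toFun h D := (δ.res_toFun h _).trans (congrArg _ (φ.app_res h D).symm)
  map_smul {U} f D := by
    change δ.toFun U (φ.app U (f • D)) = f * δ.toFun U (φ.app U D) - _
    rw [_root_.map_smul, δ.map_smul, φ.anchor_app]
  map_bracket {U} D D' := by
    change δ.toFun U (φ.app U (L'.bracket U D D')) = L'.anchor U D (δ.toFun U (φ.app U D')) -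
      L'.anchor U D' (δ.toFun U (φ.app U D))
    rw [φ.app_bracket, δ.map_bracket, φ.anchor_app, φ.anchor_app]

variable (δ : FlatDivergence L)

theorem preRes_gen {U V : Opens X} (h : V ≤ U) (a : ExteriorAlgebra (secO O U) (L.sec U)) :
    L.preRes h ((δ.onSections U).gen a) = (δ.onSections V).gen (L.preRes h a) :=
  LieRinehartData.extMap_gen _ _ _ _ (L.res_smul h) (fun m f => L.res_anchor h m f)
    (fun m m' => L.res_bracket h m m') _ _ (fun m => δ.res_toFun h m) a

theorem extAlgHom_gen (φ : Hom L' L) (U : Opens X) (a : ExteriorAlgebra (secO O U) (L'.sec U)) :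
    φ.extAlgHom U (((δ.comap φ).onSections U).gen a) = (δ.onSections U).gen (φ.extAlgHom U a) :=
  LieRinehartData.extMap_gen _ _ _ _ _
    (fun m f => (congrArg (fun d => d f) (φ.anchor_app m)).symm)
    (fun m m' => φ.app_bracket m m') _ _ (fun _ => rfl) a

/-- The operator on `⋀ L` defined by a divergence. -/
def gen (U : Opens X) : Module.End K (L.Ext U) :=
  (L.exists_extend (fun U => (δ.onSections U).gen) δ.preRes_gen).choose U

theorem gen_extRes {U V : Opens X} (h : V ≤ U) (s : L.Ext U) :
    δ.gen V (L.extRes h s) = L.extRes h (δ.gen U s) :=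
  (L.exists_extend (fun U => (δ.onSections U).gen) δ.preRes_gen).choose_spec.1 h s

theorem gen_toExt (U : Opens X) (a : ExteriorAlgebra (secO O U) (L.sec U)) :
    δ.gen U (L.toExt U a) = L.toExt U ((δ.onSections U).gen a) :=
  (L.exists_extend (fun U => (δ.onSections U).gen) δ.preRes_gen).choose_spec.2 U a

theorem generatedBracket_toExt (U : Opens X) (p : ℕ)
    (a b : ExteriorAlgebra (secO O U) (L.sec U)) :
    generatedBracket (δ.gen U) p (L.toExt U a) (L.toExt U b) =
      L.toExt U (generatedBracket (δ.onSections U).gen p a b) :=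
  (map_generatedBracket _ _ _ (fun a => (δ.gen_toExt U a).symm) p a b).symm

theorem extRes_generatedBracket {U V : Opens X} (h : V ≤ U) (p : ℕ) (a b : L.Ext U) :
    L.extRes h (generatedBracket (δ.gen U) p a b) =
      generatedBracket (δ.gen V) p (L.extRes h a) (L.extRes h b) :=
  map_generatedBracket _ _ _ (fun a => (δ.gen_extRes h a).symm) p a b

theorem gen_gen {U : Opens X} (s : L.Ext U) : δ.gen U (δ.gen U s) = 0 := by
  refine L.ext_eq_of_local _ _ fun x hx => ?_
  obtain ⟨V, h, hxV, a, e⟩ := L.exists_toExt s hx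
  refine ⟨V, h, hxV, ?_⟩
  rw [← gen_extRes, ← gen_extRes, e, gen_toExt, gen_toExt, LieRinehartData.Divergence.gen_gen,
    map_zero, map_zero]

theorem gen_degree_zero {U : Opens X} {s : L.Ext U} (hs : L.HasDegree 0 s) : δ.gen U s = 0 := by
  refine L.ext_eq_of_local _ _ fun x hx => ?_
  obtain ⟨V, h, hxV, a, ha, e⟩ := hs x hx
  obtain ⟨f, rfl⟩ := exists_algebraMap_of_mem ha
  refine ⟨V, h, hxV, ?_⟩
  rw [← gen_extRes, e, gen_toExt, LieRinehartData.Divergence.gen_algebraMap, map_zero, map_zero]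

theorem gen_degree_succ {U : Opens X} (k : ℕ) {s : L.Ext U} (hs : L.HasDegree (k + 1) s) :
    L.HasDegree k (δ.gen U s) := by
  refine L.hasDegree_of_local _ _ fun x hx => ?_
  obtain ⟨V, h, hxV, a, ha, e⟩ := hs x hx
  refine ⟨V, h, hxV, ?_⟩
  rw [← gen_extRes, e, gen_toExt]
  exact L.hasDegree_toExt k (LieRinehartData.Divergence.gen_mem _ k ha)

theorem generatedBracket_mul {U : Opens X} (p q : ℕ) {a b : L.Ext U} (e : L.Ext U)
    (ha : L.HasDegree p a) (hb : L.HasDegree q b) :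
    generatedBracket (δ.gen U) p a (b * e) = generatedBracket (δ.gen U) p a b * e +
      (-1) ^ ((p + 1) * q) * (b * generatedBracket (δ.gen U) p a e) := by
  refine L.ext_eq_of_local _ _ fun x hx => ?_
  obtain ⟨V, h, hxV, a', ha', b', hb', e', ea, eb, ee⟩ := L.exists_toExt_triple p q e ha hb hx
  refine ⟨V, h, hxV, ?_⟩
  simp only [map_add, map_mul, map_pow, map_neg, map_one, extRes_generatedBracket, ea, eb, ee]
  rw [← map_mul]
  simp only [generatedBracket_toExt]
  rw [LieRinehartData.Divergence.generatedBracket_mul _ p q e' ha' hb']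
  simp only [map_add, map_mul, map_pow, map_neg, map_one]

theorem generatedBracket_ofE_toExt {U : Opens X} (D : L.sec U)
    (a : ExteriorAlgebra (secO O U) (L.sec U)) :
    generatedBracket (δ.gen U) 1 (L.ofE U D) (L.toExt U a) =
      L.toExt U ((L.lieRinehart U).lieDer D a) := by
  rw [← L.toExt_ι, generatedBracket_toExt, LieRinehartData.Divergence.generatedBracket_ι]

theorem generatedBracket_section {U : Opens X} (D₁ D₂ : L.sec U) :
    generatedBracket (δ.gen U) 1 (L.ofE U D₁) (L.ofE U D₂) = L.ofE U (L.bracket U D₁ D₂) := by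
  rw [← L.toExt_ι U D₂, generatedBracket_ofE_toExt, LieRinehartData.lieDer_ι]
  rfl

theorem generatedBracket_function {U : Opens X} (D : L.sec U) (f : secO O U) :
    generatedBracket (δ.gen U) 1 (L.ofE U D) (L.ofO U f) = L.ofO U (L.anchor U D f) := by
  rw [← L.toExt_algebraMap, generatedBracket_ofE_toExt, LieRinehartData.lieDer_algebraMap]
  rfl

theorem gen_ofE {U : Opens X} (D : L.sec U) : δ.gen U (L.ofE U D) = L.ofO U (δ.toFun U D) := by
  rw [← L.toExt_ι, gen_toExt, LieRinehartData.Divergence.gen_ι]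
  rfl

/-- The bridge between the two descriptions of the connection, `-D ∧ Δs` and `L_D s - δ(D) s`. They
agree once `D ∧ s` vanishes, as it does in top degree. -/
theorem neg_ofE_mul_gen {U : Opens X} (D : L.sec U) {s : L.Ext U} (hs : L.ofE U D * s = 0) :
    -(L.ofE U D * δ.gen U s) =
      generatedBracket (δ.gen U) 1 (L.ofE U D) s - L.ofO U (δ.toFun U D) * s := by
  rw [generatedBracket, hs, map_zero, gen_ofE]
  simp

theorem generatedBracket_ofO_mul {U : Opens X} (D : L.sec U) (f : secO O U) (s : L.Ext U) :
    generatedBracket (δ.gen U) 1 (L.ofE U D) (L.ofO U f * s) =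
      L.ofO U f * generatedBracket (δ.gen U) 1 (L.ofE U D) s + L.ofO U (L.anchor U D f) * s := by
  rw [δ.generatedBracket_mul 1 0 s (L.hasDegree_ofE D) (L.hasDegree_ofO f),
    generatedBracket_function, mul_zero, pow_zero, one_mul, add_comm]

theorem generatedBracket_bracket {U : Opens X} (D D' : L.sec U) (s : L.Ext U) :
    generatedBracket (δ.gen U) 1 (L.ofE U (L.bracket U D D')) s =
      generatedBracket (δ.gen U) 1 (L.ofE U D) (generatedBracket (δ.gen U) 1 (L.ofE U D') s) -
      generatedBracket (δ.gen U) 1 (L.ofE U D') (generatedBracket (δ.gen U) 1 (L.ofE U D) s) := by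
  refine L.ext_eq_of_local _ _ fun x hx => ?_
  obtain ⟨V, h, hxV, a, e⟩ := L.exists_toExt s hx
  refine ⟨V, h, hxV, ?_⟩
  simp only [map_sub, extRes_generatedBracket, e, ModuleSheaf.extRes_ofE, L.res_bracket,
    generatedBracket_ofE_toExt]
  rw [← map_sub]
  exact congrArg _ (LieRinehartData.lieDer_bracket _ _ _ a)

theorem hasDegree_ofE_mul_gen {n : ℕ} {U : Opens X} (D : L.sec U) {s : L.Ext U}
    (hs : L.HasDegree n s) : L.HasDegree n (-(L.ofE U D * δ.gen U s)) := by
  refine neg_mem (S := Submodule _ (L.extModule.sec U)) ?_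
  cases n with
  -- For `n = 0` there is no degree below to lower to; the section is homogeneous because `Δ` kills
  -- degree zero.
  | zero =>
    rw [δ.gen_degree_zero hs, mul_zero]
    exact zero_mem ((L.extSub 0).carrier U)
  | succ n => exact L.hasDegree_ofE_mul D (δ.gen_degree_succ n hs)

/-- The operator `D ∧ Δ` on `⋀^n L`, up to sign. -/
def covariant (n : ℕ) (U : Opens X) (D : L.sec U) : Module.End K ((L.extPow n).sec U) where
  toFun s := L.extMk n (-(L.ofE U D * δ.gen U (L.extIncl n U s)))
    (δ.hasDegree_ofE_mul_gen D (L.extIncl_hasDegree n s))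
  map_add' s t := L.extIncl_injective n U (by
    simp only [map_add, ModuleSheaf.extIncl_extMk, mul_add, neg_add])
  map_smul' c s := L.extIncl_injective n U (by
    simp only [_root_.map_smul, ModuleSheaf.extIncl_extMk, mul_smul_comm, smul_neg,
      RingHom.id_apply])

theorem extIncl_covariant (n : ℕ) {U : Opens X} (D : L.sec U) (s : (L.extPow n).sec U) :
    L.extIncl n U (δ.covariant n U D s) = -(L.ofE U D * δ.gen U (L.extIncl n U s)) := rfl

/-- The connection on `⋀^n L` defined by a divergence. -/
def connection {n : ℕ} (hL : L.IsLocallyFree n) : Connection L (L.extPow n) where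
  toFun U :=
    { toFun := δ.covariant n U
      map_add' := fun D D' => LinearMap.ext fun s => L.extIncl_injective n U (by
        rw [LinearMap.add_apply, map_add, extIncl_covariant, extIncl_covariant, extIncl_covariant,
          L.ofE_add, add_mul, neg_add])
      map_smul' := fun f D => LinearMap.ext fun s => L.extIncl_injective n U (by
        rw [LinearMap.smul_apply, L.extIncl_smul, RingHom.id_apply, extIncl_covariant,
          extIncl_covariant, L.ofE_smul, mul_assoc, mul_neg]) }
  res_toFun {U V} h D s := L.extIncl_injective n V (by
    rw [L.extIncl_res]
    exact (congrArg (L.extRes h) (δ.extIncl_covariant n D s)).trans (by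
      rw [map_neg, map_mul, L.extRes_ofE, ← gen_extRes]
      rfl))
  leibniz {U} D f s := L.extIncl_injective n U (by
    -- Linearity in `D` was visible in the form `-D ∧ Δs`; the Leibniz rule in `s` is visible in the
    -- form `L_D s - δ(D) s`, for which top degree is needed.
    have h (t : (L.extPow n).sec U) := L.ofE_mul_eq_zero hL D (L.extIncl_hasDegree n t)
    rw [map_add, L.extIncl_smul, L.extIncl_smul]
    refine (δ.neg_ofE_mul_gen D (h (f • s))).trans ?_
    refine Eq.trans ?_ (congrArg (fun z => L.ofO U f * z + _) (δ.neg_ofE_mul_gen D (h s)).symm)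
    rw [L.extIncl_smul, generatedBracket_ofO_mul, mul_sub, ← mul_assoc, ← mul_assoc, ← map_mul,
      ← map_mul, mul_comm f]
    abel)

theorem extIncl_connection {n : ℕ} (hL : L.IsLocallyFree n) {U : Opens X} (D : L.sec U)
    (s : (L.extPow n).sec U) : L.extIncl n U ((δ.connection hL).toFun U D s) =
      -(L.ofE U D * δ.gen U (L.extIncl n U s)) := rfl

/-- For `∇_D = L_D - δ(D)` the curvature splits into that of the Lie derivative, which is zero, and
the defect of `map_bracket`. -/
theorem connection_isFlat {n : ℕ} (hL : L.IsLocallyFree n) : (δ.connection hL).IsFlat := by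
  intro U D₁ D₂ s
  refine L.extIncl_injective n U ?_
  have h (D : L.sec U) (t : (L.extPow n).sec U) :
      L.extIncl n U ((δ.connection hL).toFun U D t) = _ :=
    δ.neg_ofE_mul_gen D (L.ofE_mul_eq_zero hL D (L.extIncl_hasDegree n t))
  have hsub (D : L.sec U) (a b : L.Ext U) : generatedBracket (δ.gen U) 1 (L.ofE U D) (a - b) =
      generatedBracket (δ.gen U) 1 (L.ofE U D) a - generatedBracket (δ.gen U) 1 (L.ofE U D) b := by
    simp only [generatedBracket, mul_sub, map_sub]
    abel
  rw [map_sub, h, h, h, h, h, generatedBracket_bracket, hsub, hsub, generatedBracket_ofO_mul,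
    generatedBracket_ofO_mul, δ.map_bracket, map_sub, sub_mul, mul_sub, mul_sub, ← mul_assoc,
    ← mul_assoc, ← map_mul (L.ofO U), ← map_mul (L.ofO U), mul_comm (δ.toFun U D₁) (δ.toFun U D₂)]
  abel

/-- The generating operator defined by a divergence. -/
def generatingOperator {n : ℕ} {c : Connection L (L.extPow n)}
    (hc : ∀ (U : Opens X) (D : L.sec U) (s : (L.extPow n).sec U), L.extIncl n U (c.toFun U D s) =
      -(L.ofE U D * δ.gen U (L.extIncl n U s))) : GeneratingOperator c where
  toFun := δ.gen
  toFun_res := δ.gen_extRes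
  degree_zero := δ.gen_degree_zero
  degree_succ := δ.gen_degree_succ
  sq_zero := δ.gen_gen
  bracket_mul := δ.generatedBracket_mul
  bracket_section := δ.generatedBracket_section
  bracket_function := δ.generatedBracket_function
  connection D s := hc _ D s

end FlatDivergence

end LieAlgebroid

/-! ### From a flat connection on the top exterior power to a flat divergence. -/

namespace LieAlgebroid

variable {K : Type u} [Field K] {X : TopCat.{u}} {O : Sh X (CommAlgCat.{u} K)}
  {L' L : LieAlgebroid O} {n : ℕ}

/-- Contract the relation `D ∧ a = 0`, valid in top degree, with `df`. This converts the correction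
term of `smul_lieDer` into the term `-D(f)` of the divergence rule. -/
theorem toExt_ι_mul_contract (hL : L.IsLocallyFree n) {U : Opens X} (D : L.sec U) (f : secO O U)
    {a : ExteriorAlgebra (secO O U) (L.sec U)} (ha : a ∈ ⋀[secO O U]^n (L.sec U)) :
    L.toExt U (ExteriorAlgebra.ι _ D * (L.lieRinehart U).contract f a) =
      L.toExt U (L.anchor U D f • a) := by
  refine L.ext_eq_of_local _ _ fun x hx => ?_
  obtain ⟨W, hxW, b, -⟩ := L.exists_basis hL x
  refine ⟨U ⊓ W, inf_le_left, ⟨hx, hxW⟩, ?_⟩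
  rw [L.extRes_toExt', L.extRes_toExt', map_mul, L.preRes_ι, L.preRes_smul, L.res_anchor]
  have h : L.preRes inf_le_left ((L.lieRinehart U).contract f a) =
      (L.lieRinehart (U ⊓ W)).contract (resO O inf_le_left f) (L.preRes inf_le_left a) :=
    LieRinehartData.extMap_contract _ _ _ _ (L.res_smul _) (fun m f => L.res_anchor _ m f) f a
  have h' := (L.lieRinehart (U ⊓ W)).contract_ι_mul (resO O inf_le_left f) (L.res inf_le_left D)
    (L.preRes inf_le_left a)
  rw [ι_mul_eq_zero_of_mem (b _ inf_le_right) _ (L.preRes_mem inf_le_left n ha), map_zero, eq_comm,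
    sub_eq_zero] at h'
  rw [h, ← h']
  rfl

/-- A section of the presheaf `⋀^n L`, as a section of the sheaf `⋀^n L`. -/
def powMk (L : LieAlgebroid O) (n : ℕ) (U : Opens X) (a : ⋀[secO O U]^n (L.sec U)) :
    (L.extPow n).sec U :=
  L.extMk n (L.toExt U a) (L.hasDegree_toExt n a.2)

theorem extIncl_powMk (U : Opens X) (a : ⋀[secO O U]^n (L.sec U)) :
    L.extIncl n U (L.powMk n U a) = L.toExt U a := rfl

theorem exists_powMk {U : Opens X} (s : (L.extPow n).sec U) {x : X} (hx : x ∈ U) :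
    ∃ (V : Opens X) (h : V ≤ U), x ∈ V ∧ ∃ a, (L.extPow n).res h s = L.powMk n V a := by
  obtain ⟨V, h, hxV, a, ha, e⟩ := L.extIncl_hasDegree n s x hx
  exact ⟨V, h, hxV, ⟨a, ha⟩, L.extIncl_injective n V e⟩

/-- The function `f` is the divergence of `D` with respect to the connection `c`. -/
def IsDivergence (c : Connection L (L.extPow n)) {U : Opens X} (D : L.sec U) (f : secO O U) :
    Prop :=
  ∀ (V : Opens X) (h : V ≤ U) (a : ⋀[secO O V]^n (L.sec V)),
    L.extIncl n V (c.toFun V (L.res h D) (L.powMk n V a)) =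
      L.toExt V ((L.lieRinehart V).lieDer (L.res h D) a - resO O h f • (a : ExteriorAlgebra _ _))

namespace IsDivergence

variable {c : Connection L (L.extPow n)}

theorem res {U : Opens X} {D : L.sec U} {f : secO O U} (hf : IsDivergence c D f) {V : Opens X}
    (h : V ≤ U) : IsDivergence c (L.res h D) (resO O h f) := fun W hW a => by
  rw [L.res_res, resO_resO]
  exact hf W (hW.trans h) a

theorem apply {U : Opens X} {D : L.sec U} {f : secO O U} (hf : IsDivergence c D f)
    (a : ⋀[secO O U]^n (L.sec U)) : L.extIncl n U (c.toFun U D (L.powMk n U a)) =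
      L.toExt U ((L.lieRinehart U).lieDer D a - f • (a : ExteriorAlgebra _ _)) := by
  have h := hf U le_rfl a
  rwa [L.res_self, resO_self] at h

theorem unique (hL : L.IsLocallyFree n) {U : Opens X} {D : L.sec U} {f g : secO O U}
    (hf : IsDivergence c D f) (hg : IsDivergence c D g) : f = g :=
  L.ofO_injective_of_smul hL fun V h a ha => by
    have e := (hf V h ⟨a, ha⟩).symm.trans (hg V h ⟨a, ha⟩)
    rwa [map_sub, map_sub, sub_right_inj, L.toExt_smul, L.toExt_smul] at e

theorem of_local {U : Opens X} {D : L.sec U} {f : secO O U}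
    (h : ∀ x ∈ U, ∃ (V : Opens X) (h : V ≤ U), x ∈ V ∧
      IsDivergence c (L.res h D) (resO O h f)) : IsDivergence c D f := by
  intro V hV a
  refine L.ext_eq_of_local _ _ fun x hx => ?_
  obtain ⟨W, hW, hxW, hf⟩ := h x (hV hx)
  refine ⟨V ⊓ W, inf_le_left, ⟨hx, hxW⟩, ?_⟩
  have e := hf (V ⊓ W) inf_le_right ⟨_, L.preRes_mem inf_le_left n a.2⟩
  rw [L.res_res, resO_resO] at e
  have e' : L.powMk n (V ⊓ W) ⟨_, L.preRes_mem inf_le_left n a.2⟩ =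
      (L.extPow n).res inf_le_left (L.powMk n V a) :=
    L.extIncl_injective n _ (L.extRes_toExt' inf_le_left _).symm
  rw [L.extRes_toExt', map_sub, preRes_lieDer, L.preRes_smul, L.res_res, resO_resO,
    ← L.extIncl_res, c.res_toFun, L.res_res, ← e', e]

/-- Where `⋀^n L` is generated by a volume element `ω`, the section `L_D ω - ∇_D ω` is a multiple `f
ω`, and this `f` is the divergence. -/
theorem exists_local (hL : L.IsLocallyFree n) (c : Connection L (L.extPow n)) {U : Opens X}
    (D : L.sec U) {x : X} (hx : x ∈ U) : ∃ (V : Opens X) (h : V ≤ U), x ∈ V ∧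
      ∃ f, IsDivergence c (L.res h D) f := by
  obtain ⟨W, hxW, b, hb⟩ := L.exists_basis hL x
  let V := U ⊓ W
  let ω : ⋀[secO O V]^n (L.sec V) := ⟨_, volumeElement_mem (b V inf_le_right)⟩
  let D' : L.sec V := L.res inf_le_left D
  let η : ⋀[secO O V]^n (L.sec V) := ⟨_, (L.lieRinehart V).lieDer_mem D' n ω.2⟩
  -- The difference is a section of the sheaf; it comes from the presheaf, and so becomes a multiple
  -- of `ω`, only after shrinking the open set.
  obtain ⟨V', hV, hxV, ⟨a, ha'⟩, e⟩ :=
    exists_powMk (L.powMk n V η - c.toFun V D' (L.powMk n V ω)) (x := x) ⟨hx, hxW⟩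
  obtain ⟨f, rfl⟩ := exists_eq_smul_volumeElement (b V' (hV.trans inf_le_right)) ha'
  refine ⟨V', hV.trans inf_le_left, hxV, f, fun W' hW' a => ?_⟩
  obtain ⟨g, hg⟩ := exists_eq_smul_volumeElement (b W' (hW'.trans (hV.trans inf_le_right))) a.2
  have hle : W' ≤ V := hW'.trans hV
  let ω' : ⋀[secO O W']^n (L.sec W') := ⟨_, volumeElement_mem (b W' (hle.trans inf_le_right))⟩
  have ha : L.powMk n W' a = g • L.powMk n W' ω' :=
    L.extIncl_injective n _ (by
      rw [L.extIncl_smul, extIncl_powMk, extIncl_powMk, hg, L.toExt_smul])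
  have e' := congrArg (L.extIncl n W') (congrArg ((L.extPow n).res hW') e)
  have hω : (L.extPow n).res hle (L.powMk n V ω) = L.powMk n W' ω' :=
    L.extIncl_injective n _ ((L.extRes_toExt' hle _).trans
      (congrArg (L.toExt W') (hb V W' inf_le_right hle)))
  rw [(L.extPow n).res_res, map_sub, c.res_toFun, hω, map_sub] at e'
  have e₁ : L.extIncl n W' ((L.extPow n).res hle (L.powMk n V η)) =
      L.toExt W' ((L.lieRinehart W').lieDer (L.res hle D') ω'.1) :=
    (L.extRes_toExt' hle _).trans (congrArg (L.toExt W') ((preRes_lieDer hle D' ω.1).trans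
      (congrArg _ (hb V W' inf_le_right hle))))
  have e₂ : L.extIncl n W' ((L.extPow n).res hW' (L.powMk n V' ⟨_, ha'⟩)) =
      L.toExt W' (resO O hW' f • ω'.1) :=
    (L.extRes_toExt' hW' _).trans (congrArg (L.toExt W') ((L.preRes_smul hW' f _).trans
      (congrArg _ (hb V' W' _ hW'))))
  rw [e₁, e₂, sub_eq_iff_eq_add, ← sub_eq_iff_eq_add', L.res_res] at e'
  -- On `g ω` both operators contribute the same term `D(g) ω`, so their difference is linear over
  -- functions and its value on `ω` decides.
  rw [ha, c.leibniz, L.res_res, map_add, L.extIncl_smul, L.extIncl_smul, ← e', extIncl_powMk, hg,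
    ← map_sub, ← L.toExt_smul, ← L.toExt_smul, ← map_add]
  congr 1
  refine Eq.trans ?_ (congrArg (· - _) ((L.lieRinehart W').lieDer_smul _ g ω'.1).symm)
  rw [smul_sub, smul_smul, smul_smul, mul_comm g]
  change _ - _ + L.anchor W' _ g • _ = _ + L.anchor W' _ g • _ - _
  abel

theorem exists_isDivergence (hL : L.IsLocallyFree n) (c : Connection L (L.extPow n)) {U : Opens X}
    (D : L.sec U) : ∃ f, IsDivergence c D f := by
  obtain ⟨f, hf⟩ := exists_secO_of_local (U := U) (fun V h f => IsDivergence c (L.res h D) f)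
    (fun hV h f hf => by
      have := hf.res h
      rwa [L.res_res] at this)
    (fun hV f g hf hg => hf.unique hL hg) (fun x hx => exists_local hL c D hx)
  exact ⟨f, of_local hf⟩

theorem add {U : Opens X} {D D' : L.sec U} {f g : secO O U} (hf : IsDivergence c D f)
    (hg : IsDivergence c D' g) : IsDivergence c (D + D') (f + g) := fun V h a => by
  rw [map_add (L.res h), map_add (c.toFun V), LinearMap.add_apply, map_add (L.extIncl n V),
    hf V h a, hg V h a, ← map_add (L.toExt V), map_add (resO O h), map_add (L.lieRinehart V).lieDer,
    LinearMap.add_apply, add_smul]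
  congr 1
  abel

theorem smul {U : Opens X} {D : L.sec U} {f : secO O U} (hL : L.IsLocallyFree n) (g : secO O U)
    (hf : IsDivergence c D f) : IsDivergence c (g • D) (g * f - L.anchor U D g) := fun V h a => by
  rw [L.res_smul, _root_.map_smul, LinearMap.smul_apply, L.extIncl_smul, hf V h a, ← L.toExt_smul,
    LieRinehartData.smul_lieDer, map_sub (resO O h), map_mul (resO O h), sub_smul, L.res_anchor,
    smul_sub, mul_smul, map_sub, map_sub, map_sub, map_sub, toExt_ι_mul_contract hL _ _ a.2]
  abel

theorem const_smul {U : Opens X} {D : L.sec U} {f : secO O U} (r : K)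
    (hf : IsDivergence c D f) : IsDivergence c (r • D) (r • f) := fun V h a => by
  have e : c.toFun V (r • L.res h D) = r • c.toFun V (L.res h D) := by
    rw [← algebraMap_smul (secO O V) r (L.res h D), _root_.map_smul, algebraMap_smul]
  rw [_root_.map_smul (L.res h), e, LinearMap.smul_apply, _root_.map_smul (L.extIncl n V), hf V h a,
    ← _root_.map_smul (L.toExt V), _root_.map_smul (L.lieRinehart V).lieDer, LinearMap.smul_apply,
    smul_sub, _root_.map_smul (resO O h), smul_assoc]

theorem toFun_powMk {U : Opens X} {D : L.sec U} {f : secO O U} (hf : IsDivergence c D f)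
    (a : ⋀[secO O U]^n (L.sec U)) : c.toFun U D (L.powMk n U a) = L.powMk n U
      ⟨(L.lieRinehart U).lieDer D a - f • (a : ExteriorAlgebra _ _),
        sub_mem (LieRinehartData.lieDer_mem _ D n a.2) (Submodule.smul_mem _ _ a.2)⟩ :=
  L.extIncl_injective n U (hf.apply a)

/-- Flatness of the connection enters here: expanding `[L_D - f, L_{D'} - g]` gives `L_{[D, D']} -
(D(g) - D'(f))`. -/
theorem bracket_apply (hc : c.IsFlat) {U : Opens X} {D D' : L.sec U} {f g : secO O U}
    (hf : IsDivergence c D f) (hg : IsDivergence c D' g) (a : ⋀[secO O U]^n (L.sec U)) :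
    L.extIncl n U (c.toFun U (L.bracket U D D') (L.powMk n U a)) =
      L.toExt U ((L.lieRinehart U).lieDer (L.bracket U D D') a -
        (L.anchor U D g - L.anchor U D' f) • (a : ExteriorAlgebra _ _)) := by
  rw [hc, hf.toFun_powMk, hg.toFun_powMk, hf.toFun_powMk, hg.toFun_powMk, map_sub,
    extIncl_powMk, extIncl_powMk, ← map_sub]
  congr 1
  have hb : (L.lieRinehart U).lieDer (L.bracket U D D') a.1 = _ :=
    (L.lieRinehart U).lieDer_bracket D D' a.1
  have hs (D : L.sec U) (f : secO O U) (a : ExteriorAlgebra (secO O U) (L.sec U)) :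
      (L.lieRinehart U).lieDer D (f • a) = f • (L.lieRinehart U).lieDer D a + L.anchor U D f • a :=
    (L.lieRinehart U).lieDer_smul D f a
  dsimp only
  rw [hb, map_sub, map_sub, hs, hs, sub_smul, smul_sub, smul_sub, smul_smul, smul_smul, mul_comm g]
  abel

theorem bracket (hc : c.IsFlat) {U : Opens X} {D D' : L.sec U} {f g : secO O U}
    (hf : IsDivergence c D f) (hg : IsDivergence c D' g) :
    IsDivergence c (L.bracket U D D') (L.anchor U D g - L.anchor U D' f) := fun V h a => by
  rw [L.res_bracket, map_sub (resO O h), L.res_anchor, L.res_anchor]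
  exact bracket_apply hc (hf.res h) (hg.res h) a

end IsDivergence

/-- A flat connection on `⋀^n L` is defined by a flat divergence. -/
theorem exists_flatDivergence (hL : L.IsLocallyFree n) (c : Connection L (L.extPow n))
    (hc : c.IsFlat) : ∃ δ : FlatDivergence L, ∀ (U : Opens X) (D : L.sec U)
      (s : (L.extPow n).sec U), L.extIncl n U (c.toFun U D s) =
        -(L.ofE U D * δ.gen U (L.extIncl n U s)) := by
  choose d hd using fun (U : Opens X) (D : L.sec U) => IsDivergence.exists_isDivergence hL c D
  let δ : FlatDivergence L :=
    { toFun := fun U =>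
        { toFun := d U
          map_add' := fun D D' => (hd U _).unique hL ((hd U D).add (hd U D'))
          map_smul' := fun r D => (hd U _).unique hL ((hd U D).const_smul r) }
      res_toFun := fun h D => ((hd _ D).res h).unique hL (hd _ _)
      map_smul := fun f D => (hd _ _).unique hL ((hd _ D).smul hL f)
      map_bracket := fun D D' => (hd _ _).unique hL ((hd _ D).bracket hc (hd _ D')) }
  refine ⟨δ, fun U D s => ?_⟩
  rw [δ.neg_ofE_mul_gen D (L.ofE_mul_eq_zero hL D (L.extIncl_hasDegree n s))]
  refine L.ext_eq_of_local _ _ fun x hx => ?_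
  obtain ⟨V, h, hxV, a, e⟩ := exists_powMk s hx
  refine ⟨V, h, hxV, ?_⟩
  rw [← L.extIncl_res, c.res_toFun, e, hd U D V h a, map_sub, map_sub (L.extRes h),
    δ.extRes_generatedBracket, map_mul, ← L.extIncl_res, e, L.extRes_ofE, L.extRes_ofO,
    extIncl_powMk, δ.generatedBracket_ofE_toExt, L.toExt_smul]
  rfl

/-! ### Uniqueness of the generating operator. -/

/-- The generating operator of a connection is determined by the connection. -/
theorem GeneratingOperator.toFun_eq_gen (hL : L.IsLocallyFree n) {c : Connection L (L.extPow n)}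
    (δ : FlatDivergence L) (hδ : ∀ (U : Opens X) (D : L.sec U) (s : (L.extPow n).sec U),
      L.extIncl n U (c.toFun U D s) = -(L.ofE U D * δ.gen U (L.extIncl n U s)))
    (Γ : GeneratingOperator c) : Γ.toFun = δ.gen := by
  -- The bracket with `D` is a derivation whose values on functions and on sections of `L` are
  -- prescribed.
  have h₁ {U : Opens X} (D : L.sec U) (a : ExteriorAlgebra (secO O U) (L.sec U)) :
      generatedBracket (Γ.toFun U) 1 (L.ofE U D) (L.toExt U a) =
        generatedBracket (δ.gen U) 1 (L.ofE U D) (L.toExt U a) := by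
    induction a using ext_induction with
    | algebraMap r => rw [L.toExt_algebraMap, Γ.bracket_function, δ.generatedBracket_function]
    | add x y hx hy =>
      have hadd (T : Module.End K (L.Ext U)) (a x y : L.Ext U) : generatedBracket T 1 a (x + y) =
          generatedBracket T 1 a x + generatedBracket T 1 a y := by
        simp only [generatedBracket, map_add, mul_add, mul_sub]
        abel
      rw [map_add, hadd, hadd, hx, hy]
    | ι_mul m x hx =>
      rw [map_mul, L.toExt_ι, Γ.bracket_mul 1 1 _ (L.hasDegree_ofE D) (L.hasDegree_ofE m),
        δ.generatedBracket_mul 1 1 _ (L.hasDegree_ofE D) (L.hasDegree_ofE m), hx,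
        Γ.bracket_section, δ.generatedBracket_section]
  have h₂ {U : Opens X} (D : L.sec U) : Γ.toFun U (L.ofE U D) = L.ofO U (δ.toFun U D) := by
    refine L.ext_eq_of_local _ _ fun x hx => ?_
    obtain ⟨V, h, hxV, a, ha, e⟩ := Γ.degree_succ 0 (L.hasDegree_ofE D) x hx
    obtain ⟨f, rfl⟩ := exists_algebraMap_of_mem ha
    refine ⟨V, h, hxV, ?_⟩
    rw [L.toExt_algebraMap] at e
    rw [e, L.extRes_ofO]
    congr 1
    refine L.ofO_injective_of_smul hL fun W hW a ha => ?_
    -- For `a` of top degree `D ∧ a = 0`, so `[D, a] = Δ(D) a - D ∧ Δa`. The left side agrees for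
    -- the two operators by `h₁`, and `D ∧ Δa` agrees because it is minus the connection; hence so
    -- does `Δ(D) a`.
    have hz := L.ofE_mul_eq_zero hL (L.res (hW.trans h) D) (L.hasDegree_toExt n ha)
    have hb := h₁ (L.res (hW.trans h) D) a
    have hΓ := Γ.connection (L.res (hW.trans h) D) (L.powMk n W ⟨a, ha⟩)
    have hδ' := hδ W (L.res (hW.trans h) D) (L.powMk n W ⟨a, ha⟩)
    have he := Γ.toFun_res (hW.trans h) (L.ofE U D)
    rw [L.extRes_ofE, ← L.extRes_extRes h hW (Γ.toFun U _), e, L.extRes_ofO] at he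
    rw [hΓ, neg_inj, extIncl_powMk] at hδ'
    rw [generatedBracket, generatedBracket, hz, map_zero, map_zero, hδ', he, δ.gen_ofE] at hb
    rw [resO_resO, δ.res_toFun]
    simpa using hb
  have h₃ {U : Opens X} (a : ExteriorAlgebra (secO O U) (L.sec U)) :
      Γ.toFun U (L.toExt U a) = δ.gen U (L.toExt U a) := by
    induction a using ext_induction with
    | algebraMap r =>
      rw [L.toExt_algebraMap, Γ.degree_zero (L.hasDegree_ofO r),
        δ.gen_degree_zero (L.hasDegree_ofO r)]
    | add x y hx hy => rw [map_add, map_add, map_add, hx, hy]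
    | ι_mul m x hx =>
      -- The equality of the brackets `[m, x]` is solved for `Δ(m ∧ x)`, the other terms being equal
      -- by `h₂` and induction.
      have hb := h₁ m x
      rw [generatedBracket, generatedBracket, h₂, δ.gen_ofE, hx] at hb
      rw [map_mul, L.toExt_ι]
      simpa using hb
  funext U
  refine LinearMap.ext fun s => L.ext_eq_of_local _ _ fun x hx => ?_
  obtain ⟨V, h, hxV, a, e⟩ := L.exists_toExt s hx
  exact ⟨V, h, hxV, by rw [← Γ.toFun_res, ← δ.gen_extRes, e, h₃]⟩

/-! ### The map induced on exterior powers, and the image of an injective morphism. -/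

namespace Hom

variable (φ : Hom L' L)

theorem ext_ofE (U : Opens X) (D : L'.sec U) : φ.ext U (L'.ofE U D) = L.ofE U (φ.app U D) :=
  (φ.ext_toExt U _).trans (congrArg (L.toExt U) (extMap_ι _ _ _ D))

theorem ext_gen (δ : FlatDivergence L) (U : Opens X) (s : L'.Ext U) :
    φ.ext U ((δ.comap φ).gen U s) = δ.gen U (φ.ext U s) := by
  refine L.ext_eq_of_local _ _ fun x hx => ?_
  obtain ⟨V, h, hxV, a, e⟩ := L'.exists_toExt s hx
  refine ⟨V, h, hxV, ?_⟩
  rw [← φ.ext_res, ← δ.gen_extRes, ← FlatDivergence.gen_extRes, ← φ.ext_res, e,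
    FlatDivergence.gen_toExt, φ.ext_toExt, φ.ext_toExt, δ.gen_toExt, δ.extAlgHom_gen]

/-- Locally a section in the kernel is `f` times a volume element whose image is `f det φ` times
another, and `det φ` is not a zero divisor. -/
theorem pow_injective (hL' : L'.IsLocallyFree n) (hL : L.IsLocallyFree n)
    (hφ : ∀ U : Opens X, Function.Injective (φ.app U)) (U : Opens X) :
    Function.Injective (φ.pow n U) := by
  rw [injective_iff_map_eq_zero]
  intro s hs
  refine (L'.extPow n).eq_of_local _ _ fun x hx => ?_
  obtain ⟨W, hxW, b, hb⟩ := L.exists_basis hL x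
  obtain ⟨W', hxW', b', hb'⟩ := L'.exists_basis hL' x
  obtain ⟨V, h, hxV, ⟨a, ha⟩, e⟩ := exists_powMk s hx
  have h₀ : L.toExt V (φ.extAlgHom V a) = L.toExt V 0 := by
    have := congrArg (L.extIncl n V) (congrArg ((L.extPow n).res h) hs)
    rw [← φ.pow_res, e, map_zero, map_zero] at this
    rw [map_zero, ← φ.ext_toExt]
    exact this
  -- Vanishing in the sheaf gives vanishing in the presheaf only on a smaller open set, which is
  -- then intersected with sets where both modules are free.
  obtain ⟨V₁, h₁, hx₁, e₁⟩ := L.preRes_eq_of_toExt_eq h₀ hxV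
  let V₂ := V₁ ⊓ (W ⊓ W')
  have h₂ : V₂ ≤ V := inf_le_left.trans h₁
  obtain ⟨f, hf⟩ := exists_eq_smul_volumeElement (b' V₂ (inf_le_right.trans inf_le_right))
    (L'.preRes_mem h₂ n ha)
  have e₂ : φ.extAlgHom V₂ (L'.preRes h₂ a) = 0 := by
    have e₃ : φ.extAlgHom V₂ (L'.preRes h₂ a) = L.preRes h₂ (φ.extAlgHom V a) :=
      ConcreteCategory.congr_hom (φ.extPresheafMap.naturality (homOfLE h₂).op) a
    have e₄ (z) : L.preRes h₂ z = L.preRes inf_le_left (L.preRes h₁ z) :=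
      ConcreteCategory.congr_hom
        (L.extPresheaf.map_comp (homOfLE h₁).op (homOfLE (inf_le_left : V₂ ≤ V₁)).op) z
    rw [e₃, e₄, e₁, map_zero, map_zero]
  have e₅ : φ.extAlgHom V₂ = (ExteriorAlgebra.map (φ.app V₂)).restrictScalars K :=
    ext_algHom _ _ (fun r => (extMap_algebraMap _ _ _ r).trans
        (AlgHom.commutes (ExteriorAlgebra.map (φ.app V₂)) r).symm)
      (fun m => (extMap_ι _ _ _ m).trans (ExteriorAlgebra.map_apply_ι (φ.app V₂) m).symm)
  have hf₀ : f = 0 := by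
    rw [hf, e₅] at e₂
    refine smul_map_volumeElement_eq_zero (b' V₂ (inf_le_right.trans inf_le_right))
      (b V₂ (inf_le_right.trans inf_le_left)) (φ.app V₂) (hφ V₂) ?_
    rw [← map_smul]
    exact e₂
  refine ⟨V₂, h₂.trans h, ⟨hx₁, hxW, hxW'⟩, L'.extIncl_injective n V₂ ?_⟩
  rw [← (L'.extPow n).res_res h h₂, e, L'.extIncl_res, extIncl_powMk, L'.extRes_toExt', hf, hf₀,
    zero_smul, map_zero, map_zero, map_zero]

/-- Sections of the image sheaf have preimages only locally; injectivity makes these agree on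
overlaps, so they glue. -/
theorem toImage_bijective (hφ : ∀ U : Opens X, Function.Injective (φ.app U)) (U : Opens X) :
    Function.Bijective (φ.toImage U) := by
  refine ⟨fun t t' h => hφ U (congrArg (φ.imageSub.val U) h), fun s => ?_⟩
  choose V hV hxV t ht using fun x : U => φ.imageSub.val_mem s x.1 x.2
  obtain ⟨r, hr, -⟩ := TopCat.Sheaf.existsUnique_gluing' (F := L'.toSheaf) V U
    (fun x => homOfLE (hV x)) (fun x hx => Opens.mem_iSup.2 ⟨⟨x, hx⟩, hxV _⟩) t (fun x y => by
      refine hφ _ ?_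
      change φ.app _ (L'.res (V := V x ⊓ V y) inf_le_left (t x)) =
        φ.app _ (L'.res inf_le_right (t y))
      rw [φ.app_res, φ.app_res, ht, ht, L.res_res, L.res_res])
  refine ⟨r, φ.imageSub.val_injective U (L.eq_of_local _ _ fun x hx => ?_)⟩
  refine ⟨V ⟨x, hx⟩, hV _, hxV _, ?_⟩
  have h : L'.res (hV ⟨x, hx⟩) r = t ⟨x, hx⟩ := hr ⟨x, hx⟩
  change L.res _ (φ.app U r) = _
  rw [← φ.app_res, h, ht]

/-- If `φ` is injective, every connection is relative to `φ`. -/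
theorem isRelative_of_injective {E : ModuleSheaf O}
    (hφ : ∀ U : Opens X, Function.Injective (φ.app U)) (c : Connection L' E) :
    c.IsRelative φ := by
  -- `t` is the inverse of `toImage`; the connection is transported along it, once it is known to be
  -- linear and compatible with restriction.
  choose t ht using fun U => (φ.toImage_bijective hφ U).surjective
  have ht' (U : Opens X) (D : L'.sec U) : t U (φ.toImage U D) = D :=
    (φ.toImage_bijective hφ U).injective (ht U _)
  have hval {U : Opens X} (s : φ.image.sec U) : φ.app U (t U s) = φ.imageSub.val U s :=
    congrArg (φ.imageSub.val U) (ht U s)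
  have hadd {U : Opens X} (s s' : φ.image.sec U) : t U (s + s') = t U s + t U s' := hφ U (by
    rw [map_add, hval, hval, hval]
    rfl)
  have hsmul {U : Opens X} (f : secO O U) (s : φ.image.sec U) : t U (f • s) = f • t U s :=
    hφ U (by
      rw [_root_.map_smul, hval, hval]
      rfl)
  have hres {U V : Opens X} (h : V ≤ U) (s : φ.image.sec U) :
      t V (φ.image.res h s) = L'.res h (t U s) := hφ V (by
    rw [φ.app_res, hval, hval]
    rfl)
  refine ⟨{ toFun := fun U =>
              { toFun := fun s => c.toFun U (t U s)
                map_add' := fun s s' => by rw [hadd, map_add]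
                map_smul' := fun f s => by rw [hsmul, _root_.map_smul, RingHom.id_apply] }
            res_toFun := fun h D s => by
              refine (c.res_toFun h _ s).trans ?_
              rw [← hres]
              rfl
            leibniz := fun {U} D f s => by
              refine (c.leibniz (t U D) f s).trans ?_
              rw [← φ.anchor_app, hval]
              rfl }, fun U D => ?_⟩
  exact congrArg (c.toFun U) (ht' U D).symm

end Hom

end LieAlgebroid

end LieAlgd

/-! ### The morphism of complexes and the main theorem. -/

namespace LieAlgd

namespace LieAlgebroid

variable {K : Type u} [Field K] {X : TopCat.{u}} {O : Sh X (CommAlgCat.{u} K)}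
  {L' L : LieAlgebroid O} {n : ℕ}

theorem GeneratingOperator.eq_generatingOperator (hL : L.IsLocallyFree n)
    {c : Connection L (L.extPow n)} (δ : FlatDivergence L)
    (hδ : ∀ (U : Opens X) (D : L.sec U) (s : (L.extPow n).sec U),
      L.extIncl n U (c.toFun U D s) = -(L.ofE U D * δ.gen U (L.extIncl n U s)))
    (Γ : GeneratingOperator c) : Γ = δ.generatingOperator hδ :=
  GeneratingOperator.ext (Γ.toFun_eq_gen hL δ hδ)

/-- The morphism of complexes `⋀ φ`, for generating operators that `⋀ φ` intertwines. -/
def Hom.complexMap (φ : Hom L' L) {c' : Connection L' (L'.extPow n)}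
    {c : Connection L (L.extPow n)} (Δ' : GeneratingOperator c') (Δ : GeneratingOperator c)
    (h : ∀ (U : Opens X) (s : L'.Ext U), φ.ext U (Δ'.toFun U s) = Δ.toFun U (φ.ext U s)) :
    Δ'.complex ⟶ Δ.complex :=
  ChainComplex.ofHom (fun k => φ.powHom k) fun k => by
    have e : φ.powHom (k + 1) ≫ Δ.boundary k = Δ'.boundary k ≫ φ.powHom k := by
      apply Sheaf.hom_ext
      ext U s
      refine L.extIncl_injective k U.unop ?_
      refine (Δ.extIncl_boundarySec k U.unop (φ.pow (k + 1) U.unop s)).trans ?_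
      refine Eq.trans ?_ (congrArg (φ.ext U.unop) (Δ'.extIncl_boundarySec k U.unop s)).symm
      -- The signs of the two boundaries coincide because they depend only on `k` and the common
      -- rank `n`.
      rw [_root_.map_smul, h]
      rfl
    have d : Δ.complex.d (k + 1) k = Δ.boundary k :=
      ChainComplex.of_d (fun k => (L.extPow k).toSheaf) Δ.boundary k
    have d' : Δ'.complex.d (k + 1) k = Δ'.boundary k :=
      ChainComplex.of_d (fun k => (L'.extPow k).toSheaf) Δ'.boundary k
    exact (congrArg (φ.powHom (k + 1) ≫ ·) d).trans (e.trans (congrArg (· ≫ φ.powHom k) d'.symm))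

end LieAlgebroid

end LieAlgd

end

theorem mainTheorem7 {K : Type u} [Field K] [CharZero K] {X : TopCat.{u}}
    (O : LieAlgd.Sh X (CommAlgCat.{u} K)) (L' L : LieAlgd.LieAlgebroid O) (n : ℕ)
    (hL' : L'.IsLocallyFree n) (hL : L.IsLocallyFree n)
    (φ : LieAlgd.LieAlgebroid.Hom L' L) (hφ : ∀ U : Opens X, Function.Injective (φ.app U))
    (c : LieAlgd.LieAlgebroid.Connection L (L.extPow n)) (hc : c.IsFlat) :
    ∃ c' : LieAlgd.LieAlgebroid.Connection L' (L'.extPow n),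
      (∀ (U : Opens X) (D : L'.sec U) (s : (L'.extPow n).sec U),
        φ.pow n U (c'.toFun U D s) = c.toFun U (φ.app U D) (φ.pow n U s)) ∧
      (∀ b : LieAlgd.LieAlgebroid.Connection L' (L'.extPow n),
        (∀ (U : Opens X) (D : L'.sec U) (s : (L'.extPow n).sec U),
          φ.pow n U (b.toFun U D s) = c.toFun U (φ.app U D) (φ.pow n U s)) → b = c') ∧
      c'.IsRelative φ ∧ c'.IsFlat ∧
      ∃ (Δ' : LieAlgd.LieAlgebroid.GeneratingOperator c')
        (Δ : LieAlgd.LieAlgebroid.GeneratingOperator c),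
        (∀ Γ : LieAlgd.LieAlgebroid.GeneratingOperator c', Γ = Δ') ∧
        (∀ Γ : LieAlgd.LieAlgebroid.GeneratingOperator c, Γ = Δ) ∧
        ∃ Φ : Δ'.complex ⟶ Δ.complex,
          (∀ k : ℕ, Φ.f k = φ.powHom k) ∧
          ∃ H : ∀ k : ℤ, LieAlgd.hyperhomology Δ'.complex k →ₗ[K]
              LieAlgd.hyperhomology Δ.complex k,
            ∀ k : ℤ, H k = LieAlgd.hyperhomologyMap Φ k := by
  obtain ⟨δ, hδ⟩ := LieAlgd.LieAlgebroid.exists_flatDivergence hL c hc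
  let δ' := δ.comap φ
  -- Both connections have the form `-D ∧ Δs`, and `⋀ φ` respects products and intertwines the
  -- operators.
  have hφc : ∀ (U : Opens X) (D : L'.sec U) (s : (L'.extPow n).sec U),
      φ.pow n U ((δ'.connection hL').toFun U D s) = c.toFun U (φ.app U D) (φ.pow n U s) :=
    fun U D s => L.extIncl_injective n U (by
      rw [hδ]
      refine (congrArg (φ.ext U) (δ'.extIncl_connection hL' D s)).trans ?_
      rw [map_neg, map_mul, φ.ext_ofE, φ.ext_gen]
      rfl)
  have hδ' : ∀ (U : Opens X) (D : L'.sec U) (s : (L'.extPow n).sec U),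
      L'.extIncl n U ((δ'.connection hL').toFun U D s) =
        -(L'.ofE U D * δ'.gen U (L'.extIncl n U s)) :=
    fun _ D s => δ'.extIncl_connection hL' D s
  refine ⟨δ'.connection hL', hφc, fun b hb => ?_, φ.isRelative_of_injective hφ _,
    δ'.connection_isFlat hL', δ'.generatingOperator hδ', δ.generatingOperator hδ,
    fun Γ => Γ.eq_generatingOperator hL' δ' hδ', fun Γ => Γ.eq_generatingOperator hL δ hδ,
    φ.complexMap _ _ (φ.ext_gen δ), fun k => rfl, fun k => LieAlgd.hyperhomologyMap _ k,
    fun k => rfl⟩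
  refine LieAlgd.LieAlgebroid.Connection.ext ?_
  funext U
  -- After the injective map `⋀^n φ`, both connections become the same expression in `c`.
  refine LinearMap.ext fun D => LinearMap.ext fun s => φ.pow_injective hL' hL hφ U ?_
  rw [hb, hφc]
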